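/- Let $\mathbb T=\mathbb R/2\pi\mathbb Z$, let $\hat f(\tau,\xi,q)$, $(\tau,\xi,q)\in\mathbb R\times\mathbb R\times\mathbb Z$, denote the space-time Fourier transform of a complex-valued function $f(t,x,y)$ on $\mathbb R\times\mathbb R\times\mathbb T$, and write $\langle a\rangle=(1+|a|^2)^{1/2}$, where $|a|$ is the Euclidean norm. Put $\phi(\xi,q)=\xi(\xi^2+q^2)$. For $s,b\ge 0$ let $X_{s,b}$ be the space of all $f\in L^2(\mathbb R\times\mathbb R\times\mathbb T)$ with $$\|f\|_{X_{s,b}}=\Big(\int_{\mathbb R}\int_{\mathbb R}\sum_{q\in\mathbb Z}\langle(\xi,q)\rangle^{2s}\,\langle\tau-\phi(\xi,q)\rangle^{2b}\,|\hat f(\tau,\xi,q)|^2\,d\tau\,d\xi\Big)^{1/2}<\infty .$$ For $\alpha\in[0,1]$ and constants $c_1,c_2>0$ let $P^\alpha$ be the Fourier projector in $(x,y)$ with symbol the indicator function of $$\{(\xi,q)\in\mathbb R\times\mathbb Z:\ |3\xi^2-q^2|\ge c_1|\xi|^\alpha,\ |\xi|\ge c_2\},$$ and for $s\ge 0$ let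 $I_x^{s}$ be the Fourier multiplier operator with symbol $|\xi|^{s}$. **Proposition (bilinear refinement of the linear $L^4$-estimate).** Let $\varepsilon>0$, $b>\frac12$ and $c_1,c_2>0$. There is a constant $C>0$, depending only on $\varepsilon,b,c_1,c_2$, such that for all $\alpha\in[0,1]$ and all $u,v\in X_{\varepsilon,b}$ the function $I_x^{\alpha/4}P^\alpha(uv)$, whose Fourier transform is $|\xi|^{\alpha/4}$ times the indicator function above times $\widehat{uv}$, belongs to $L^2(\mathbb R\times\mathbb R\times\mathbb T)$ and satisfies $$\|I_x^{\alpha/4}P^\alpha(uv)\|_{L^2(\mathbb R\times\mathbb R\times\mathbb T)}\le C\,\|u\|_{X_{\varepsilon,b}}\,\|v\|_{X_{\varepsilon,b}} .$$ -/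

import Mathlib

open MeasureTheory FourierTransform
open scoped ENNReal Real

noncomputable section

namespace ZK

/-- The circle `ℝ / 2πℤ`, whose characters are `y ↦ exp (i q y)` for `q ∈ ℤ`, needs a positive
period. -/
instance instFactTwoPiPos : Fact (0 < 2 * π) := ⟨Real.two_pi_pos⟩

/-- The Euclidean plane, used both for the variables `(t, x)` and for the dual variables
`(τ, ξ)`. -/
abbrev Plane : Type := EuclideanSpace ℝ (Fin 2)

/-- The torus `𝕋 = ℝ / 2πℤ`. -/
abbrev Torus : Type := AddCircle (2 * π)

/-- Space-time `ℝ × ℝ × 𝕋`: a point is `(z, y)` with `t = z 0` and `x = z 1`. It carries the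
product of the Lebesgue measures. -/
abbrev SpaceTime : Type := Plane × Torus

/-- The complex Hilbert space `L²(ℝ × ℝ × 𝕋)`. -/
abbrev L2 : Type := Lp ℂ 2 (volume : Measure SpaceTime)

/-- The `q`-th Fourier coefficient in the periodic variable,
`(t, x) ↦ ∫_𝕋 exp (- i q y) f(t, x, y) dy`. -/
def coeffY (f : SpaceTime → ℂ) (q : ℤ) (z : Plane) : ℂ :=
  ∫ y : Torus, fourier (-q) y * f (z, y)

/-- The Fourier coefficients in `y` of a square integrable function are square integrable. -/
theorem memLp_coeffY {f : SpaceTime → ℂ} (hf : MemLp f 2 volume) (q : ℤ) :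
    MemLp (coeffY f q) 2 volume := by
  have hm : AEStronglyMeasurable (fun p : SpaceTime => fourier (-q) p.2 * f p)
      ((volume : Measure Plane).prod (volume : Measure Torus)) :=
    (((fourier (-q)).continuous.comp continuous_snd).aestronglyMeasurable).mul
      hf.aestronglyMeasurable
  have hf' : AEStronglyMeasurable f
      ((volume : Measure Plane).prod (volume : Measure Torus)) := hf.aestronglyMeasurable
  refine ⟨hm.integral_prod_right', ?_⟩
  have htop := (eLpNorm_lt_top_iff_lintegral_rpow_enorm_lt_top (by norm_num) (by norm_num)).1 hf.2
  refine (eLpNorm_lt_top_iff_lintegral_rpow_enorm_lt_top (by norm_num) (by norm_num)).2 ?_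
  simp only [ENNReal.toReal_ofNat, ENNReal.rpow_ofNat] at htop ⊢
  set M : ℝ≥0∞ := (volume : Measure Torus) Set.univ with hM
  have hMtop : M < ∞ := measure_lt_top _ _
  have key : ∀ᵐ z : Plane, ‖coeffY f q z‖ₑ ^ 2 ≤ M * ∫⁻ y : Torus, ‖f (z, y)‖ₑ ^ 2 := by
    filter_upwards [hf'.prodMk_left] with z hz
    have h1 : ‖coeffY f q z‖ₑ ≤ ∫⁻ y : Torus, ‖f (z, y)‖ₑ := by
      refine (enorm_integral_le_lintegral_enorm _).trans (le_of_eq ?_)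
      refine lintegral_congr fun y => ?_
      have : ‖(fourier (-q) y : ℂ)‖ₑ = 1 := by
        rw [← ofReal_norm, fourier_apply, Circle.norm_coe, ENNReal.ofReal_one]
      rw [enorm_mul, this, one_mul]
    have h2 := ENNReal.lintegral_mul_le_Lp_mul_Lq (volume : Measure Torus)
      (Real.HolderConjugate.two_two) (aemeasurable_const (b := (1 : ℝ≥0∞))) hz.enorm
    simp only [Pi.mul_apply, one_mul, ENNReal.rpow_ofNat, one_pow, lintegral_one] at h2
    calc ‖coeffY f q z‖ₑ ^ 2 ≤ (∫⁻ y : Torus, ‖f (z, y)‖ₑ) ^ 2 := by gcongr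
      _ ≤ (M ^ (1 / 2 : ℝ) * (∫⁻ y : Torus, ‖f (z, y)‖ₑ ^ 2) ^ (1 / 2 : ℝ)) ^ 2 := by gcongr
      _ = M * ∫⁻ y : Torus, ‖f (z, y)‖ₑ ^ 2 := by
        rw [mul_pow, ← ENNReal.rpow_ofNat, ← ENNReal.rpow_ofNat, ← ENNReal.rpow_mul,
          ← ENNReal.rpow_mul]
        norm_num
  refine (lintegral_mono_ae key).trans_lt ?_
  rw [lintegral_const_mul' _ _ hMtop.ne]
  refine ENNReal.mul_lt_top hMtop ?_
  have h3 := lintegral_prod (μ := (volume : Measure Plane)) (ν := (volume : Measure Torus))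
    (fun p : SpaceTime => ‖f p‖ₑ ^ 2) (hf'.enorm.pow_const 2)
  rw [← h3]
  exact htop

/-- The space-time Fourier transform of an integrable function on `ℝ × ℝ × 𝕋`,
`(τ, ξ, q) ↦ ∫ exp (- i (t τ + x ξ + q y)) w(t, x, y) d(t, x, y)`, with `ζ = (τ, ξ)`.
The dilation by `(2π)⁻¹` is due to the kernel `exp (- 2 π i ⟪z, ζ⟫)` of `𝓕`. -/
def fourierL1 (w : SpaceTime → ℂ) (ζ : Plane) (q : ℤ) : ℂ :=
  𝓕 (coeffY w q) ((2 * π)⁻¹ • ζ)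

/-- The space-time Fourier transform `û(τ, ξ, q)` of a square integrable function, with the same
normalization as `fourierL1`: the Fourier coefficient in `y`, followed by the Fourier-Plancherel
transform in `(t, x)`. It is defined for almost every `ζ = (τ, ξ)`. -/
def fourierL2 (u : L2) (ζ : Plane) (q : ℤ) : ℂ :=
  (𝓕 ((memLp_coeffY (Lp.memLp u) q).toLp (coeffY u q)) : Lp ℂ 2 (volume : Measure Plane))
    ((2 * π)⁻¹ • ζ)

/-- The phase function `φ(ξ, q) = ξ (ξ² + q²)`. -/
def phase (ξ : ℝ) (q : ℤ) : ℝ := ξ * (ξ ^ 2 + (q : ℝ) ^ 2)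

/-- The Japanese bracket `⟨a⟩ = (1 + a²)^(1/2)` of a real number. -/
def bracket (a : ℝ) : ℝ := Real.sqrt (1 + a ^ 2)

/-- The Japanese bracket `⟨(ξ, q)⟩ = (1 + ξ² + q²)^(1/2)`. -/
def bracket₂ (ξ : ℝ) (q : ℤ) : ℝ := Real.sqrt (1 + ξ ^ 2 + (q : ℝ) ^ 2)

/-- The Bourgain norm
`‖u‖_{X_{s,b}} = (∫∫ ∑_q ⟨(ξ,q)⟩^{2s} ⟨τ - φ(ξ,q)⟩^{2b} |û(τ,ξ,q)|² dτ dξ)^{1/2} ∈ [0, ∞]`. -/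
def bourgainNorm (s b : ℝ) (u : L2) : ℝ≥0∞ :=
  (∫⁻ ζ : Plane, ∑' q : ℤ,
    ENNReal.ofReal (bracket₂ (ζ 1) q ^ (2 * s) * bracket (ζ 0 - phase (ζ 1) q) ^ (2 * b)
      * ‖fourierL2 u ζ q‖ ^ 2)) ^ (1 / 2 : ℝ)

/-- The Bourgain space `X_{s,b}` for `s, b ≥ 0`. For such indices the weight in the norm is at
least `1`, so that every element of `X_{s,b}` is a square integrable function. -/
def bourgainSpace (s b : ℝ) : Set L2 := {u | bourgainNorm s b u < ∞}

/-- The frequency region `|3ξ² - q²| ≥ c₁ |ξ|^α`, `|ξ| ≥ c₂`. -/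
def freqRegion (α c₁ c₂ : ℝ) : Set (ℝ × ℤ) :=
  {p | c₁ * |p.1| ^ α ≤ |3 * p.1 ^ 2 - (p.2 : ℝ) ^ 2| ∧ c₂ ≤ |p.1|}

/-- The symbol of the Fourier projector `P^α` onto `freqRegion α c₁ c₂`. -/
def projSymbol (α c₁ c₂ : ℝ) (ξ : ℝ) (q : ℤ) : ℝ :=
  (freqRegion α c₁ c₂).indicator 1 (ξ, q)

/-- The symbol `|ξ|^s` of the Riesz potential operator `I_x^s`. -/
def rieszSymbol (s : ℝ) (ξ : ℝ) (_q : ℤ) : ℝ := |ξ| ^ s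

/-- `g ∈ L²` is the image of the integrable function `w` under the Fourier multiplier operator
`𝓕_{xy}⁻¹ m(ξ, q) 𝓕_{xy}`: its space-time Fourier transform is `m(ξ, q) ŵ(τ, ξ, q)`. By
Plancherel's theorem there is at most one such `g`. -/
def IsMultiplierImage (m : ℝ → ℤ → ℝ) (w : SpaceTime → ℂ) (g : L2) : Prop :=
  Integrable w volume ∧
    ∀ᵐ ζ : Plane, ∀ q : ℤ, fourierL2 g ζ q = (m (ζ 1) q : ℂ) * fourierL1 w ζ q

end ZK

end

open MeasureTheory FourierTransform
open scoped ENNReal Real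

noncomputable section

namespace ZK

open scoped ComplexConjugate

/-! By Plancherel the estimate is an `L²` bound on the frequency side for the symbol times the
convolution of the two Fourier transforms. Cauchy-Schwarz against the weights of the Bourgain norm
(`lintegral_mul_sq_convolution_le`) reduces it to a uniform bound on `|ξ|^(α/2)` times the
convolution of the inverse weights, `bilinearKernel`, on the frequency region.

To bound that kernel, the integral over the inner time frequency, with `2b > 1`, leaves `⟨τ - φ(x,p)
- φ(ξ-x,q-p)⟩^(-2b)`. By `phase_add_phase` the sum of phases is a constant plus `3ξ(x-x₀)² +
D(p-q/2)²` with `D = (3ξ²-q²)/(3ξ)`. The `x`-integral therefore gains `|ξ|^(-1/2) (1 + |T -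
D(p-q/2)²|^(1/2))⁻¹`. In `p` this decays only like `1/|p|`, so its sum may diverge logarithmically;
the `ε` derivatives supply the missing decay, and the sum is `≲ 1 + |D|^(-1/2)`
(`tsum_inv_mul_decay_le`). The kernel is thus `≲ |ξ|^(-1/2) + |3ξ²-q²|^(-1/2)`, and the two
conditions of the frequency region together with `α ≤ 1` absorb `|ξ|^(α/2)`.

It remains to justify the frequency picture. The product of two `L²` functions is only integrable,
so its transform is identified with the convolution of Plancherel transforms, by density of Schwartz
functions in `(t,x)` and Parseval in `y`. The `L²` function `g` is then built by inverting the
transform (`exists_fourierL2_eq`). -/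

/-! ### Integrals and sums of decaying powers -/

/-- The integral of `(1 + |s|) ^ (-r)` over the real line. -/
def decayIntegral (r : ℝ) : ℝ≥0∞ := ∫⁻ s : ℝ, ENNReal.ofReal ((1 + |s|) ^ (-r))

/-- The sum of `(1 + |p|) ^ (-r)` over the integers. -/
def decaySum (r : ℝ) : ℝ≥0∞ := ∑' p : ℤ, ENNReal.ofReal ((1 + |(p : ℝ)|) ^ (-r))

theorem decayIntegral_lt_top {r : ℝ} (hr : 1 < r) : decayIntegral r < ∞ := by
  have := finite_integral_one_add_norm (E := ℝ) (μ := volume) (r := r) (by simpa using hr)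
  simpa [decayIntegral, Real.norm_eq_abs] using this

theorem decaySum_lt_top {r : ℝ} (hr : 1 < r) : decaySum r < ∞ := by
  have h1 : Summable fun p : ℤ => |(p : ℝ)| ^ (-r) := Real.summable_abs_int_rpow hr
  have h2 : Summable fun p : ℤ => (if p = 0 then (1 : ℝ) else 0) :=
    summable_of_hasFiniteSupport (by
      refine (Set.finite_singleton (0 : ℤ)).subset fun p hp => ?_
      by_contra h
      simp_all)
  have h3 : Summable fun p : ℤ => (1 + |(p : ℝ)|) ^ (-r) := by
    refine Summable.of_nonneg_of_le (fun p => by positivity) (fun p => ?_) (h1.add h2)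
    rcases eq_or_ne p 0 with rfl | hp
    · have : (0 : ℝ) ^ (-r) = 0 := Real.zero_rpow (by linarith)
      simp [this]
    · have hp' : 0 < |(p : ℝ)| := abs_pos.2 (by exact_mod_cast hp)
      simp only [hp, if_false, add_zero]
      exact Real.rpow_le_rpow_of_nonpos hp' (by linarith) (by linarith)
  exact h3.tsum_ofReal_lt_top

theorem lintegral_comp_mul_left {f : ℝ → ℝ≥0∞} (hf : Measurable f) {a : ℝ} (ha : a ≠ 0) :
    ∫⁻ y : ℝ, f (a * y) = ENNReal.ofReal |a⁻¹| * ∫⁻ y, f y := by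
  rw [← lintegral_map hf (measurable_const_mul a), Real.map_volume_mul_left ha,
    lintegral_smul_measure, smul_eq_mul]

theorem lintegral_decay_affine (r ν : ℝ) {a : ℝ} (ha : a ≠ 0) :
    ∫⁻ y : ℝ, ENNReal.ofReal ((1 + |a * y - ν|) ^ (-r)) =
      ENNReal.ofReal |a⁻¹| * decayIntegral r := by
  rw [lintegral_comp_mul_left (f := fun y => ENNReal.ofReal ((1 + |y - ν|) ^ (-r)))
    (by fun_prop) ha, lintegral_sub_right_eq_self
      (fun y => ENNReal.ofReal ((1 + |y|) ^ (-r))) ν, decayIntegral]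

theorem rpow_neg_le_of_le_mul {x y c r : ℝ} (hy : 0 < y) (hc : 0 < c) (hr : 0 ≤ r)
    (h : y ≤ c * x) : x ^ (-r) ≤ c ^ r * y ^ (-r) := by
  have hx : 0 < x := by
    by_contra h'
    nlinarith [mul_nonneg hc.le (neg_nonneg.2 (not_lt.1 h'))]
  have h1 : (c * x) ^ (-r) ≤ y ^ (-r) := Real.rpow_le_rpow_of_nonpos hy h (by linarith)
  rw [Real.mul_rpow hc.le hx.le] at h1
  calc x ^ (-r) = c ^ r * (c ^ (-r) * x ^ (-r)) := by
        rw [← mul_assoc, ← Real.rpow_add hc]; simp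
    _ ≤ _ := by gcongr

/-- By the triangle inequality the larger of the two bases on the left is at least half of `1 + |c -
a|`. Its power gives the decay in `c - a`, and the other power stays integrable in `s`. -/
theorem decay_mul_decay_le {r : ℝ} (hr : 0 ≤ r) (a c s : ℝ) :
    (1 + |s - a|) ^ (-r) * (1 + |c - s|) ^ (-r) ≤
      2 ^ r * (1 + |c - a|) ^ (-r) * ((1 + |s - a|) ^ (-r) + (1 + |c - s|) ^ (-r)) := by
  have htri : |c - a| ≤ |s - a| + |c - s| := by
    have := abs_add_le (c - s) (s - a)
    rw [show c - s + (s - a) = c - a by ring] at this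
    linarith
  set X := 1 + |s - a| with hX
  set Y := 1 + |c - s| with hY
  have hX0 : 0 < X := by positivity
  have hY0 : 0 < Y := by positivity
  have hZ0 : 0 < 1 + |c - a| := by positivity
  rcases le_total X Y with h | h
  · have := rpow_neg_le_of_le_mul hZ0 two_pos hr (show 1 + |c - a| ≤ 2 * Y by linarith)
    have h2 : 0 ≤ 2 ^ r * (1 + |c - a|) ^ (-r) * Y ^ (-r) := by positivity
    nlinarith [mul_le_mul_of_nonneg_left this (show 0 ≤ X ^ (-r) by positivity)]
  · have := rpow_neg_le_of_le_mul hZ0 two_pos hr (show 1 + |c - a| ≤ 2 * X by linarith)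
    have h2 : 0 ≤ 2 ^ r * (1 + |c - a|) ^ (-r) * X ^ (-r) := by positivity
    nlinarith [mul_le_mul_of_nonneg_left this (show 0 ≤ Y ^ (-r) by positivity)]

theorem lintegral_decay_mul_decay_le {r : ℝ} (hr : 0 ≤ r) (a c : ℝ) :
    ∫⁻ s : ℝ, ENNReal.ofReal ((1 + |s - a|) ^ (-r) * (1 + |c - s|) ^ (-r)) ≤
      ENNReal.ofReal (2 ^ r) * (2 * decayIntegral r) * ENNReal.ofReal ((1 + |c - a|) ^ (-r)) := by
  calc _ ≤ ∫⁻ s : ℝ, ENNReal.ofReal (2 ^ r * (1 + |c - a|) ^ (-r)) *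
        (ENNReal.ofReal ((1 + |s - a|) ^ (-r)) + ENNReal.ofReal ((1 + |c - s|) ^ (-r))) := by
        refine lintegral_mono fun s => ?_
        rw [← ENNReal.ofReal_add (by positivity) (by positivity),
          ← ENNReal.ofReal_mul (by positivity)]
        exact ENNReal.ofReal_le_ofReal (decay_mul_decay_le hr a c s)
    _ = ENNReal.ofReal (2 ^ r * (1 + |c - a|) ^ (-r)) * (decayIntegral r + decayIntegral r) := by
        rw [lintegral_const_mul _ (by fun_prop), lintegral_add_left (by fun_prop),
          lintegral_sub_right_eq_self (fun s => ENNReal.ofReal ((1 + |s|) ^ (-r))) a,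
          lintegral_sub_left_eq_self (fun s => ENNReal.ofReal ((1 + |s|) ^ (-r))) c]
        rfl
    _ = _ := by
        rw [ENNReal.ofReal_mul (by positivity)]
        ring

/-- The reverse triangle inequality, with `|A| - |l| y²` factored as a difference of squares. -/
theorem abs_sub_sq_ge (A l y : ℝ) :
    |(√|A|) - (√|l|) * (|y|)| * ((√|A|) + (√|l|) * (|y|)) ≤ |A - l * y ^ 2| := by
  have h1 : 0 ≤ (√|A|) + (√|l|) * (|y|) := by positivity
  rw [← abs_of_nonneg h1, ← abs_mul,
    show ((√|A|) - (√|l|) * (|y|)) * ((√|A|) + (√|l|) * (|y|)) =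
      (√|A|) ^ 2 - (√|l|) ^ 2 * |y| ^ 2 by ring,
    Real.sq_sqrt (abs_nonneg _), Real.sq_sqrt (abs_nonneg _)]
  have h2 := abs_abs_sub_abs_le_abs_sub A (l * y ^ 2)
  rwa [abs_mul, abs_pow] at h2

/-- Linearizes `|a² - t²|` near its zero: up to constants it dominates a linear function of slope `1
+ a`. This slope is the source of the gain `(1 + √|A|)⁻¹` after integration. -/
theorem one_add_mul_abs_sub_le {a t : ℝ} (ha : 0 ≤ a) (ht : 0 ≤ t) :
    1 + (1 + a) * |t - a| ≤ 2 * (1 + |a - t| * (a + t)) := by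
  rw [abs_sub_comm t a]
  have h1 : |a - t| ≤ a + t := by rw [abs_le]; constructor <;> linarith
  nlinarith [abs_nonneg (a - t), mul_nonneg (abs_nonneg (a - t)) ha,
    mul_nonneg (abs_nonneg (a - t)) ht, mul_le_mul_of_nonneg_left h1 (abs_nonneg (a - t)),
    sq_nonneg (|a - t| - 1)]

/-- The two terms on the right correspond to the two signs of `y`; each is an affine profile that
integrates by scaling. -/
theorem decay_sub_sq_le {r : ℝ} (hr : 0 ≤ r) (A l y : ℝ) :
    (1 + |A - l * y ^ 2|) ^ (-r) ≤ 2 ^ r *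
      ((1 + |(1 + (√|A|)) * (√|l|) * y - (1 + (√|A|)) * (√|A|)|) ^ (-r) +
       (1 + |-((1 + (√|A|)) * (√|l|)) * y - (1 + (√|A|)) * (√|A|)|) ^ (-r)) := by
  set a := (√|A|) with ha
  set ρ := (√|l|) with hρ
  have ha0 : 0 ≤ a := Real.sqrt_nonneg _
  have hρ0 : 0 ≤ ρ := Real.sqrt_nonneg _
  have h1 := abs_sub_sq_ge A l y
  have h2 := one_add_mul_abs_sub_le ha0 (mul_nonneg hρ0 (abs_nonneg y))
  have h3 := rpow_neg_le_of_le_mul (r := r) (by positivity) two_pos hr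
    (h2.trans (mul_le_mul_of_nonneg_left (add_le_add_right h1 1) zero_le_two))
  refine h3.trans (mul_le_mul_of_nonneg_left ?_ (by positivity))
  have h4 : (1 + a) * |ρ * (|y|) - a| = |(1 + a) * ρ * (|y|) - (1 + a) * a| := by
    rw [← abs_of_nonneg (show 0 ≤ 1 + a by positivity), ← abs_mul,
      abs_of_nonneg (show 0 ≤ 1 + a by positivity)]
    ring_nf
  rw [h4]
  rcases abs_choice y with h | h <;> rw [h]
  · exact le_add_of_nonneg_right (by positivity)
  · rw [show (1 + a) * ρ * -y = -((1 + a) * ρ) * y by ring]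
    exact le_add_of_nonneg_left (by positivity)

theorem lintegral_decay_sub_sq_le {r : ℝ} (hr : 0 ≤ r) (A : ℝ) {l : ℝ} (hl : l ≠ 0) :
    ∫⁻ y : ℝ, ENNReal.ofReal ((1 + |A - l * y ^ 2|) ^ (-r)) ≤
      ENNReal.ofReal (2 ^ r) * (2 * decayIntegral r) *
        ENNReal.ofReal ((√|l|)⁻¹ * (1 + (√|A|))⁻¹) := by
  have hρ : 0 < (√|l|) := Real.sqrt_pos.2 (abs_pos.2 hl)
  have hμ : 0 < (1 + (√|A|)) * (√|l|) := by positivity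
  calc _ ≤ ∫⁻ y : ℝ, ENNReal.ofReal (2 ^ r) *
        (ENNReal.ofReal ((1 + |(1 + (√|A|)) * (√|l|) * y - (1 + (√|A|)) * (√|A|)|) ^ (-r)) +
        ENNReal.ofReal ((1 + |-((1 + (√|A|)) * (√|l|)) * y - (1 + (√|A|)) * (√|A|)|) ^ (-r))) := by
        refine lintegral_mono fun y => ?_
        rw [← ENNReal.ofReal_add (by positivity) (by positivity),
          ← ENNReal.ofReal_mul (by positivity)]
        exact ENNReal.ofReal_le_ofReal (decay_sub_sq_le hr A l y)
    _ = _ := by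
        rw [lintegral_const_mul _ (by fun_prop), lintegral_add_left (by fun_prop),
          lintegral_decay_affine _ _ hμ.ne', lintegral_decay_affine _ _ (neg_ne_zero.2 hμ.ne'),
          inv_neg, abs_neg, abs_of_pos (inv_pos.2 hμ), mul_inv, mul_comm (1 + (√|A|))⁻¹]
        ring

/-- Replacing `x` by its integer part moves each point by less than `1`, which the factor `2 ^ r`
absorbs. -/
theorem tsum_decay_sub_le {r : ℝ} (hr : 0 ≤ r) (x : ℝ) :
    ∑' p : ℤ, ENNReal.ofReal ((1 + |(p : ℝ) - x|) ^ (-r)) ≤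
      ENNReal.ofReal (2 ^ r) * decaySum r := by
  calc _ ≤ ∑' p : ℤ, ENNReal.ofReal (2 ^ r) *
        ENNReal.ofReal ((1 + |((p - ⌊x⌋ : ℤ) : ℝ)|) ^ (-r)) := by
        refine ENNReal.tsum_le_tsum fun p => ?_
        rw [← ENNReal.ofReal_mul (by positivity)]
        refine ENNReal.ofReal_le_ofReal (rpow_neg_le_of_le_mul (by positivity) two_pos hr ?_)
        push_cast
        have h1 := abs_add_le ((p : ℝ) - x) (x - ⌊x⌋)
        rw [show (p : ℝ) - x + (x - ⌊x⌋) = p - ⌊x⌋ by ring,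
          abs_of_nonneg (sub_nonneg.2 (Int.floor_le x))] at h1
        linarith [Int.lt_floor_add_one x, abs_nonneg ((p : ℝ) - x)]
    _ = _ := by
        rw [ENNReal.tsum_mul_left, decaySum]
        congr 1
        exact (Equiv.subRight ⌊x⌋).tsum_eq
          (fun p : ℤ => ENNReal.ofReal ((1 + |(p : ℝ)|) ^ (-r)))

/-! ### Sum over the periodic frequency -/

/-- The weight of a point in the sum over the periodic frequency. -/
theorem inv_mul_decay_le {δ : ℝ} (hδ : 0 < δ) (hδ' : δ ≤ 1 / 2) (T k : ℝ) {D : ℝ} (hD : D ≠ 0) :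
    (1 + √|T - D * k ^ 2|)⁻¹ * (1 + |k|) ^ (-(2 * δ)) ≤ 4 * (1 + (√|D|)⁻¹) *
      ((1 + |k - (√|T / D|)|) ^ (-(1 + 2 * δ)) + (1 + |k - -(√|T / D|)|) ^ (-(1 + 2 * δ))
        + (1 + |k|) ^ (-(1 + 2 * δ))) := by
  set κ := (√|T / D|) with hκ
  have hκ0 : 0 ≤ κ := Real.sqrt_nonneg _
  have hD0 : 0 < √|D| := Real.sqrt_pos.2 (abs_pos.2 hD)
  set a := |κ - (|k|)| with ha
  have ha0 : 0 ≤ a := abs_nonneg _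
  have hk0 : 0 ≤ |k| := abs_nonneg _
  have key : (1 + √|T - D * k ^ 2|)⁻¹ * (1 + |k|) ^ (-(2 * δ)) ≤ 4 * (1 + (√|D|)⁻¹) *
      ((1 + a) ^ (-(1 + 2 * δ)) + (1 + |k|) ^ (-(1 + 2 * δ))) := by
    -- `a` is the distance from `|k|` to `κ`. For `a ≤ 1` no decay is needed: the left side is at
    -- most `1`, while `(1 + a)^(-(1 + 2δ)) ≥ 1/4` because `1 + 2δ ≤ 2`. This is where the constant
    -- `4` comes from.
    rcases le_total a 1 with h1 | h1
    · have h2 : (1 + √|T - D * k ^ 2|)⁻¹ ≤ 1 := inv_le_one_of_one_le₀ (by simp)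
      have h3 : (1 + |k|) ^ (-(2 * δ)) ≤ 1 :=
        Real.rpow_le_one_of_one_le_of_nonpos (by linarith) (by linarith)
      have h4 : (1 : ℝ) ≤ 4 * (1 + a) ^ (-(1 + 2 * δ)) := by
        have h5 : (2 : ℝ) ^ (-(2 : ℝ)) ≤ (1 + a) ^ (-(1 + 2 * δ)) :=
          (Real.rpow_le_rpow_of_exponent_le one_le_two (by linarith)).trans
            (Real.rpow_le_rpow_of_nonpos (by positivity) (by linarith) (by linarith))
        rw [Real.rpow_neg zero_le_two, show (2 : ℝ) ^ (2 : ℝ) = 4 by norm_num] at h5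
        linarith
      have h6 : 0 ≤ (√|D|)⁻¹ * (1 + a) ^ (-(1 + 2 * δ)) := by positivity
      have h7 : 0 ≤ (1 + (√|D|)⁻¹) * (1 + |k|) ^ (-(1 + 2 * δ)) := by positivity
      have h8 : (1 + √|T - D * k ^ 2|)⁻¹ * (1 + |k|) ^ (-(2 * δ)) ≤ 1 :=
        mul_le_one₀ h2 (by positivity) h3
      nlinarith
    · set c := κ + |k| with hc
      have hac : a ≤ c := by rw [ha, hc, abs_le]; constructor <;> linarith
      have hkc : |k| ≤ c := by linarith
      have h2 : √|D| * √(a * c) ≤ √|T - D * k ^ 2| := by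
        rw [← Real.sqrt_mul (abs_nonneg _)]
        refine Real.sqrt_le_sqrt ?_
        have h3 := abs_sub_sq_ge (T / D) 1 k
        simp only [abs_one, Real.sqrt_one, one_mul] at h3
        calc |D| * (a * c) ≤ |D| * |T / D - k ^ 2| := by gcongr
          _ = |T - D * k ^ 2| := by rw [← abs_mul]; congr 1; field_simp
      have hA0 : 0 < 1 + a := by linarith
      have hK0 : 0 < 1 + |k| := by linarith
      set u := (1 + a) ^ (1 / 2 + δ) with hu
      set w := (1 + |k|) ^ (1 / 2 - δ) with hw
      have hu0 : 0 < u := by positivity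
      have hw0 : 0 < w := by positivity
      -- Since `c` dominates both `a` and `|k|`, its power `1/2` can be divided: `δ` goes to `1 + a`
      -- and `1/2 - δ` to `1 + |k|`. With the extra weight `(1 + |k|)^(-2δ)` both factors acquire
      -- the exponent `-(1/2 + δ)`, and a product of two such powers is bounded by the sum of their
      -- squares, which are summable.
      have h4 : u * w ≤ 2 * √(a * c) := by
        have e1 : u = (1 + a) ^ (1 / 2 : ℝ) * (1 + a) ^ δ := Real.rpow_add hA0 _ _
        have e2 : (1 + a) ^ (1 / 2 : ℝ) ≤ (2 * a) ^ (1 / 2 : ℝ) := by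
          gcongr; linarith
        have e3 : (1 + a) ^ δ ≤ (2 * c) ^ δ := by gcongr; linarith
        have e4 : w ≤ (2 * c) ^ (1 / 2 - δ) :=
          Real.rpow_le_rpow hK0.le (by linarith) (by linarith)
        have hc0 : 0 < 2 * c := by linarith
        calc u * w ≤ (2 * a) ^ (1 / 2 : ℝ) * (2 * c) ^ δ * (2 * c) ^ (1 / 2 - δ) := by
              rw [e1]; gcongr
          _ = (2 * a) ^ (1 / 2 : ℝ) * (2 * c) ^ (1 / 2 : ℝ) := by
              rw [mul_assoc, ← Real.rpow_add hc0]; ring_nf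
          _ = 2 * √(a * c) := by
              rw [← Real.mul_rpow (by positivity) hc0.le, ← Real.sqrt_eq_rpow,
                show 2 * a * (2 * c) = 2 ^ 2 * (a * c) by ring,
                Real.sqrt_mul (by positivity), Real.sqrt_sq zero_le_two]
      have h5 : (1 + √|T - D * k ^ 2|)⁻¹ ≤ 2 * (√|D|)⁻¹ * (u⁻¹ * w⁻¹) := by
        rw [← mul_inv, show 2 * (√|D|)⁻¹ * (u * w)⁻¹ = (√|D| * (u * w) / 2)⁻¹ by
          field_simp]
        refine inv_anti₀ (by positivity) ?_
        nlinarith [mul_le_mul_of_nonneg_left h4 hD0.le]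
      have h6 : w⁻¹ * (1 + |k|) ^ (-(2 * δ)) = (1 + |k|) ^ (-(1 / 2 + δ)) := by
        rw [hw, ← Real.rpow_neg hK0.le, ← Real.rpow_add hK0]; ring_nf
      have h7 : u⁻¹ = (1 + a) ^ (-(1 / 2 + δ)) := by rw [hu, Real.rpow_neg hA0.le]
      have h8 : ∀ x : ℝ, 0 < x → (x ^ (-(1 / 2 + δ))) ^ 2 = x ^ (-(1 + 2 * δ)) := fun x hx => by
        rw [← Real.rpow_natCast, ← Real.rpow_mul hx.le]; congr 1; push_cast; ring
      calc _ ≤ 2 * (√|D|)⁻¹ * (u⁻¹ * w⁻¹) * (1 + |k|) ^ (-(2 * δ)) := by gcongr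
        _ = 2 * (√|D|)⁻¹ * ((1 + a) ^ (-(1 / 2 + δ)) * (1 + |k|) ^ (-(1 / 2 + δ))) := by
            rw [← h6, ← h7]; ring
        _ ≤ 2 * (√|D|)⁻¹ * ((1 + a) ^ (-(1 + 2 * δ)) + (1 + |k|) ^ (-(1 + 2 * δ))) := by
            rw [← h8 _ hA0, ← h8 _ hK0]
            gcongr
            nlinarith [sq_nonneg ((1 + a) ^ (-(1 / 2 + δ)) - (1 + |k|) ^ (-(1 / 2 + δ))),
              sq_nonneg ((1 + a) ^ (-(1 / 2 + δ))), sq_nonneg ((1 + |k|) ^ (-(1 / 2 + δ)))]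
        _ ≤ _ := by
            gcongr ?_ * _
            have := inv_pos.2 hD0
            linarith
  refine key.trans ?_
  gcongr
  rcases abs_choice k with h | h
  · rw [ha, abs_sub_comm, h]
    exact le_add_of_nonneg_right (by positivity)
  · rw [ha, h, show κ - -k = k - -κ by ring]
    exact le_add_of_nonneg_left (by positivity)

theorem tsum_inv_mul_decay_le {δ : ℝ} (hδ : 0 < δ) (hδ' : δ ≤ 1 / 2) (T h : ℝ) {D : ℝ}
    (hD : D ≠ 0) :
    ∑' p : ℤ, ENNReal.ofReal
        ((1 + √|T - D * ((p : ℝ) - h) ^ 2|)⁻¹ * (1 + |(p : ℝ) - h|) ^ (-(2 * δ))) ≤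
      ENNReal.ofReal (1 + (√|D|)⁻¹) *
        (12 * (ENNReal.ofReal (2 ^ (1 + 2 * δ)) * decaySum (1 + 2 * δ))) := by
  set κ := (√|T / D|) with hκ
  set r := 1 + 2 * δ with hr
  have hr0 : 0 ≤ r := by positivity
  calc _ ≤ ∑' p : ℤ, ENNReal.ofReal (4 * (1 + (√|D|)⁻¹)) *
        (ENNReal.ofReal ((1 + |(p : ℝ) - (h + κ)|) ^ (-r)) +
          ENNReal.ofReal ((1 + |(p : ℝ) - (h - κ)|) ^ (-r)) +
          ENNReal.ofReal ((1 + |(p : ℝ) - h|) ^ (-r))) := by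
        refine ENNReal.tsum_le_tsum fun p => ?_
        rw [← ENNReal.ofReal_add (by positivity) (by positivity),
          ← ENNReal.ofReal_add (by positivity) (by positivity),
          ← ENNReal.ofReal_mul (by positivity)]
        refine ENNReal.ofReal_le_ofReal ((inv_mul_decay_le hδ hδ' T _ hD).trans (le_of_eq ?_))
        rw [sub_sub, sub_sub, ← sub_eq_add_neg]
    _ ≤ ENNReal.ofReal (4 * (1 + (√|D|)⁻¹)) *
        (ENNReal.ofReal (2 ^ r) * decaySum r + ENNReal.ofReal (2 ^ r) * decaySum r +
          ENNReal.ofReal (2 ^ r) * decaySum r) := by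
        rw [ENNReal.tsum_mul_left, ENNReal.tsum_add, ENNReal.tsum_add]
        gcongr <;> exact tsum_decay_sub_le hr0 _
    _ = _ := by
        rw [ENNReal.ofReal_mul (by positivity), ENNReal.ofReal_ofNat]
        ring

/-! ### Resonance identity and bound for the kernel -/

theorem rpow_neg_bracket_le {r : ℝ} (hr : 0 ≤ r) (a : ℝ) :
    bracket a ^ (-r) ≤ 2 ^ r * (1 + |a|) ^ (-r) := by
  refine rpow_neg_le_of_le_mul (by positivity) two_pos hr ?_
  have h : (1 + |a|) / 2 ≤ bracket a := by
    refine Real.le_sqrt_of_sq_le ?_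
    nlinarith [sq_nonneg (|a| - 1), sq_abs a, sq_nonneg a]
  linarith

/-- The points `p` and `q - p` are symmetric about `q/2`, and `p² + (q-p)² = 2(p - q/2)² + q²/2`, so
the product of the brackets controls `|p - q/2|`. Both brackets are at least `1`, which allows
lowering `ε` to `δ`. -/
theorem bracket₂_mul_rpow_neg_le {ε δ : ℝ} (hδ : 0 ≤ δ) (h : δ ≤ ε) (x y : ℝ) (p q : ℤ) :
    bracket₂ x p ^ (-(2 * ε)) * bracket₂ y (q - p) ^ (-(2 * ε)) ≤
      2 ^ (2 * δ) * (1 + |(p : ℝ) - q / 2|) ^ (-(2 * δ)) := by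
  have h0 : ∀ (x : ℝ) (p : ℤ), 1 ≤ bracket₂ x p := fun x p => by
    refine Real.le_sqrt_of_sq_le ?_
    nlinarith [sq_nonneg x, sq_nonneg (p : ℝ)]
  have h1 := h0 x p
  have h2 := h0 y (q - p)
  rw [← Real.mul_rpow (by linarith) (by linarith)]
  refine (Real.rpow_le_rpow_of_exponent_le (one_le_mul_of_one_le_of_one_le h1 h2)
    (show -(2 * ε) ≤ -(2 * δ) by linarith)).trans ?_
  refine rpow_neg_le_of_le_mul (by positivity) two_pos (by positivity) ?_
  have h3 : (1 + |(p : ℝ) - q / 2|) / 2 ≤ bracket₂ x p * bracket₂ y (q - p) := by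
    rw [bracket₂, bracket₂, ← Real.sqrt_mul (by positivity)]
    refine Real.le_sqrt_of_sq_le ?_
    push_cast
    set P : ℝ := (p : ℝ)
    set Q : ℝ := (q : ℝ)
    have e1 : (1 + P ^ 2) * (1 + (Q - P) ^ 2) ≤
        (1 + x ^ 2 + P ^ 2) * (1 + y ^ 2 + (Q - P) ^ 2) := by
      gcongr
      · nlinarith [sq_nonneg x]
      · nlinarith [sq_nonneg y]
    have e2 : ((1 + |P - Q / 2|) / 2) ^ 2 ≤ (1 + (P - Q / 2) ^ 2) / 2 := by
      nlinarith [sq_nonneg (|P - Q / 2| - 1), sq_abs (P - Q / 2)]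
    refine (e2.trans ?_).trans e1
    nlinarith [sq_nonneg (P + (Q - P)), sq_nonneg (P * (Q - P)), sq_nonneg P, sq_nonneg (Q - P)]
  linarith

/-- Around the symmetric point `(ξ/2, q/2)` the odd terms cancel, leaving a quadratic form in `(x -
ξ/2, p - q/2)` with matrix entries `3ξ, q, ξ` and determinant `3ξ² - q²`. The right side completes
the square in `x`. -/
theorem phase_add_phase {ξ : ℝ} (hξ : ξ ≠ 0) (x : ℝ) (p q : ℤ) :
    phase x p + phase (ξ - x) (q - p) = phase ξ q / 4 +
      3 * ξ * (x - (ξ / 2 - q * ((p : ℝ) - q / 2) / (3 * ξ))) ^ 2 +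
      (3 * ξ ^ 2 - (q : ℝ) ^ 2) / (3 * ξ) * ((p : ℝ) - q / 2) ^ 2 := by
  unfold phase
  push_cast
  field_simp
  ring

/-- The constant in `lintegral_bracket_mul_bracket_le`. -/
def modulationConst (b : ℝ) : ℝ≥0∞ :=
  ENNReal.ofReal (2 ^ (2 * b) * 2 ^ (2 * b)) *
    (ENNReal.ofReal (2 ^ (2 * b)) * (2 * decayIntegral (2 * b)))

theorem modulationConst_lt_top {b : ℝ} (hb : 1 / 2 < b) : modulationConst b < ∞ := by
  have := decayIntegral_lt_top (r := 2 * b) (by linarith)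
  exact ENNReal.mul_lt_top ENNReal.ofReal_lt_top (ENNReal.mul_lt_top ENNReal.ofReal_lt_top
    (ENNReal.mul_lt_top (by simp) this))

theorem lintegral_bracket_mul_bracket_le {b : ℝ} (hb : 0 ≤ b) (a c τ : ℝ) :
    ∫⁻ s : ℝ, ENNReal.ofReal (bracket (s - a) ^ (-(2 * b)) * bracket (τ - s - c) ^ (-(2 * b))) ≤
      modulationConst b * ENNReal.ofReal ((1 + |τ - (a + c)|) ^ (-(2 * b))) := by
  have hb2 : 0 ≤ 2 * b := by linarith
  calc _ ≤ ∫⁻ s : ℝ, ENNReal.ofReal (2 ^ (2 * b) * 2 ^ (2 * b)) *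
        ENNReal.ofReal ((1 + |s - a|) ^ (-(2 * b)) * (1 + |τ - c - s|) ^ (-(2 * b))) := by
        refine lintegral_mono fun s => ?_
        rw [← ENNReal.ofReal_mul (by positivity)]
        refine ENNReal.ofReal_le_ofReal ?_
        rw [sub_right_comm τ c s]
        calc _ ≤ (2 ^ (2 * b) * (1 + |s - a|) ^ (-(2 * b))) *
              (2 ^ (2 * b) * (1 + |τ - s - c|) ^ (-(2 * b))) := by
              have : 0 ≤ bracket (τ - s - c) := Real.sqrt_nonneg _
              gcongr <;> exact rpow_neg_bracket_le hb2 _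
          _ = _ := by ring
    _ ≤ _ := by
        rw [lintegral_const_mul _ (by fun_prop), modulationConst, mul_assoc (ENNReal.ofReal _)]
        gcongr
        refine (lintegral_decay_mul_decay_le hb2 a (τ - c)).trans (le_of_eq ?_)
        rw [show τ - c - a = τ - (a + c) by ring]

/-- After translating `x` to the vertex of the parabola only `A - 3ξx²` remains. The dependence of
`A` on `p` is kept, as it drives the convergence of the sum over `p`. -/
theorem lintegral_modulation_le {b : ℝ} (hb : 0 ≤ b) (τ : ℝ) {ξ : ℝ} (hξ : ξ ≠ 0) (p q : ℤ) :
    ∫⁻ x : ℝ, ENNReal.ofReal ((1 + |τ - (phase x p + phase (ξ - x) (q - p))|) ^ (-(2 * b))) ≤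
      ENNReal.ofReal (2 ^ (2 * b)) * (2 * decayIntegral (2 * b)) * ENNReal.ofReal ((√|3 * ξ|)⁻¹ *
        (1 + √|τ - phase ξ q / 4 -
          (3 * ξ ^ 2 - (q : ℝ) ^ 2) / (3 * ξ) * ((p : ℝ) - q / 2) ^ 2|)⁻¹) := by
  have h := lintegral_decay_sub_sq_le (r := 2 * b) (by linarith) (τ - phase ξ q / 4 -
    (3 * ξ ^ 2 - (q : ℝ) ^ 2) / (3 * ξ) * ((p : ℝ) - q / 2) ^ 2)
    (l := 3 * ξ) (mul_ne_zero three_ne_zero hξ)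
  refine le_trans (le_of_eq ?_) h
  refine Eq.trans (lintegral_congr fun x => ?_) (lintegral_sub_right_eq_self _
    (ξ / 2 - q * ((p : ℝ) - q / 2) / (3 * ξ)))
  rw [phase_add_phase hξ, show ∀ a u v w : ℝ, a - (u + v + w) = a - u - w - v by intros; ring]

/-- The kernel that appears when the bilinear estimate is reduced to a pointwise bound by the
Cauchy-Schwarz inequality. -/
def bilinearKernel (ε b τ ξ : ℝ) (q : ℤ) : ℝ≥0∞ :=
  ∑' p : ℤ, ∫⁻ x : ℝ, ∫⁻ s : ℝ,
    ENNReal.ofReal (bracket₂ x p ^ (-(2 * ε)) * bracket (s - phase x p) ^ (-(2 * b))) *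
    ENNReal.ofReal (bracket₂ (ξ - x) (q - p) ^ (-(2 * ε)) *
      bracket (τ - s - phase (ξ - x) (q - p)) ^ (-(2 * b)))

/-- The constant in `bilinearKernel_le`. -/
def kernelConst (δ b : ℝ) : ℝ≥0∞ :=
  ENNReal.ofReal (2 ^ (2 * δ)) * modulationConst b *
    (ENNReal.ofReal (2 ^ (2 * b)) * (2 * decayIntegral (2 * b))) *
    (12 * (ENNReal.ofReal (2 ^ (1 + 2 * δ)) * decaySum (1 + 2 * δ)))

theorem kernelConst_lt_top {δ b : ℝ} (hδ : 0 < δ) (hb : 1 / 2 < b) : kernelConst δ b < ∞ := by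
  have h1 := decayIntegral_lt_top (r := 2 * b) (by linarith)
  have h2 := decaySum_lt_top (r := 1 + 2 * δ) (by linarith)
  have h3 := modulationConst_lt_top hb
  exact ENNReal.mul_lt_top (ENNReal.mul_lt_top (ENNReal.mul_lt_top ENNReal.ofReal_lt_top h3)
    (ENNReal.mul_lt_top ENNReal.ofReal_lt_top (ENNReal.mul_lt_top (by simp) h1)))
    (ENNReal.mul_lt_top (by simp) (ENNReal.mul_lt_top ENNReal.ofReal_lt_top h2))

theorem bilinearKernel_le {ε δ b : ℝ} (hδ : 0 < δ) (hδ' : δ ≤ 1 / 2) (h : δ ≤ ε) (hb : 0 ≤ b)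
    (τ : ℝ) {ξ : ℝ} (hξ : ξ ≠ 0) {q : ℤ} (hq : 3 * ξ ^ 2 - (q : ℝ) ^ 2 ≠ 0) :
    bilinearKernel ε b τ ξ q ≤ kernelConst δ b * ENNReal.ofReal ((√|3 * ξ|)⁻¹ *
      (1 + (√|(3 * ξ ^ 2 - (q : ℝ) ^ 2) / (3 * ξ)|)⁻¹)) := by
  set D := (3 * ξ ^ 2 - (q : ℝ) ^ 2) / (3 * ξ) with hD
  have hD0 : D ≠ 0 := div_ne_zero hq (mul_ne_zero three_ne_zero hξ)
  set M := modulationConst b with hM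
  set N := ENNReal.ofReal (2 ^ (2 * b)) * (2 * decayIntegral (2 * b)) with hN
  have hpos : ∀ (x : ℝ) (p : ℤ), 0 ≤ bracket₂ x p := fun _ _ => Real.sqrt_nonneg _
  have hpos' : ∀ x : ℝ, 0 ≤ bracket x := fun _ => Real.sqrt_nonneg _
  have step : ∀ p : ℤ, ∫⁻ x : ℝ, ∫⁻ s : ℝ,
      ENNReal.ofReal (bracket₂ x p ^ (-(2 * ε)) * bracket (s - phase x p) ^ (-(2 * b))) *
      ENNReal.ofReal (bracket₂ (ξ - x) (q - p) ^ (-(2 * ε)) *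
        bracket (τ - s - phase (ξ - x) (q - p)) ^ (-(2 * b))) ≤
      ENNReal.ofReal (2 ^ (2 * δ)) * M * N * ENNReal.ofReal (√|3 * ξ|)⁻¹ *
        ENNReal.ofReal ((1 + √|τ - phase ξ q / 4 - D * ((p : ℝ) - q / 2) ^ 2|)⁻¹ *
          (1 + |(p : ℝ) - q / 2|) ^ (-(2 * δ))) := fun p => by
    set W := ENNReal.ofReal (2 ^ (2 * δ) * (1 + |(p : ℝ) - q / 2|) ^ (-(2 * δ))) with hW
    calc _ ≤ ∫⁻ x : ℝ, W * (M * ENNReal.ofReal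
            ((1 + |τ - (phase x p + phase (ξ - x) (q - p))|) ^ (-(2 * b)))) := by
          refine lintegral_mono fun x => ?_
          calc _ = ∫⁻ s : ℝ, ENNReal.ofReal
                  (bracket₂ x p ^ (-(2 * ε)) * bracket₂ (ξ - x) (q - p) ^ (-(2 * ε))) *
                ENNReal.ofReal (bracket (s - phase x p) ^ (-(2 * b)) *
                  bracket (τ - s - phase (ξ - x) (q - p)) ^ (-(2 * b))) := by
                refine lintegral_congr fun s => ?_
                have := hpos x p
                have := hpos (ξ - x) (q - p)
                have := hpos' (s - phase x p)
                rw [← ENNReal.ofReal_mul (by positivity), ← ENNReal.ofReal_mul (by positivity)]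
                congr 1
                ring
            _ ≤ _ := by
                rw [lintegral_const_mul' _ _ ENNReal.ofReal_ne_top]
                gcongr
                · exact ENNReal.ofReal_le_ofReal (bracket₂_mul_rpow_neg_le hδ.le h _ _ _ _)
                · exact lintegral_bracket_mul_bracket_le hb _ _ _
      _ = W * (M * ∫⁻ x : ℝ, ENNReal.ofReal
            ((1 + |τ - (phase x p + phase (ξ - x) (q - p))|) ^ (-(2 * b)))) := by
          have hm : Measurable fun x : ℝ => ENNReal.ofReal
              ((1 + |τ - (phase x p + phase (ξ - x) (q - p))|) ^ (-(2 * b))) := by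
            unfold phase
            fun_prop
          rw [lintegral_const_mul _ (hm.const_mul _), lintegral_const_mul _ hm]
      _ ≤ W * (M * (N * ENNReal.ofReal ((√|3 * ξ|)⁻¹ *
            (1 + √|τ - phase ξ q / 4 - D * ((p : ℝ) - q / 2) ^ 2|)⁻¹))) := by
          gcongr
          exact lintegral_modulation_le hb τ hξ p q
      _ = _ := by
          rw [hW, ENNReal.ofReal_mul (by positivity), ENNReal.ofReal_mul (by positivity),
            ENNReal.ofReal_mul (p := (1 + √|τ - phase ξ q / 4 - D * ((p : ℝ) - q / 2) ^ 2|)⁻¹)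
              (by positivity)]
          ring
  refine (ENNReal.tsum_le_tsum step).trans ?_
  rw [ENNReal.tsum_mul_left]
  refine (mul_le_mul_right (tsum_inv_mul_decay_le hδ hδ' _ _ hD0) _).trans (le_of_eq ?_)
  rw [kernelConst, ENNReal.ofReal_mul (by positivity)]
  ring

/-- Since `√|3ξ| √|m/(3ξ)| = √|m|`, there are two terms. In the first, `α ≤ 1` handles `|ξ| ≥ 1` and
the bound `c₂ ≤ |ξ|` handles `|ξ| ≤ 1`; in the second, the lower bound on `|m|` cancels `|ξ|^(α/2)`.
The result does not depend on `α`. -/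
theorem rpow_mul_inv_sqrt_mul_le {α c₁ c₂ ξ : ℝ} (hα : α ≤ 1) (hc₁ : 0 < c₁)
    (hc₂ : 0 < c₂) (hξ : c₂ ≤ |ξ|) {m : ℝ} (hm : c₁ * |ξ| ^ α ≤ |m|) (hα0 : 0 ≤ α) :
    |ξ| ^ (α / 2) * ((√|3 * ξ|)⁻¹ * (1 + (√|m / (3 * ξ)|)⁻¹)) ≤
      1 + (√c₂)⁻¹ + (√c₁)⁻¹ := by
  have hx : 0 < |ξ| := hc₂.trans_le hξ
  have hxa : 0 < |ξ| ^ α := by positivity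
  have hm0 : 0 < |m| := lt_of_lt_of_le (by positivity) hm
  have e0 : |ξ| ^ (α / 2) = √(|ξ| ^ α) := by
    rw [Real.sqrt_eq_rpow, ← Real.rpow_mul hx.le]; ring_nf
  have e1 : |ξ| ^ (α / 2) * (√|3 * ξ|)⁻¹ ≤ 1 + (√c₂)⁻¹ := by
    have f1 : √|ξ| ≤ √|3 * ξ| := Real.sqrt_le_sqrt (by
      rw [abs_mul, abs_of_pos (three_pos : (0 : ℝ) < 3)]; linarith)
    have f2 : 0 < √|ξ| := Real.sqrt_pos.2 hx
    calc |ξ| ^ (α / 2) * (√|3 * ξ|)⁻¹ ≤ |ξ| ^ (α / 2) * (√|ξ|)⁻¹ := by gcongr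
      _ ≤ 1 + (√c₂)⁻¹ := by
        rcases le_total 1 |ξ| with h1 | h1
        · have : |ξ| ^ (α / 2) ≤ √|ξ| := by
            rw [Real.sqrt_eq_rpow]
            exact Real.rpow_le_rpow_of_exponent_le h1 (by linarith)
          have h2 : |ξ| ^ (α / 2) * (√|ξ|)⁻¹ ≤ 1 := by
            rw [← div_eq_mul_inv]; exact div_le_one_of_le₀ this f2.le
          have : 0 < (√c₂)⁻¹ := by positivity
          linarith
        · have h2 : |ξ| ^ (α / 2) ≤ 1 := Real.rpow_le_one hx.le h1 (by linarith)
          have h3 : (√|ξ|)⁻¹ ≤ (√c₂)⁻¹ := by gcongr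
          have h4 : 0 < (√|ξ|)⁻¹ := by positivity
          nlinarith
  have e2 : |ξ| ^ (α / 2) * (√|3 * ξ|)⁻¹ * (√|m / (3 * ξ)|)⁻¹ ≤ (√c₁)⁻¹ := by
    rw [mul_assoc, ← mul_inv, ← Real.sqrt_mul (abs_nonneg _), ← abs_mul,
      mul_div_cancel₀ _ (mul_ne_zero three_ne_zero (abs_pos.1 hx)), e0, ← div_eq_mul_inv,
      ← Real.sqrt_div hxa.le, ← Real.sqrt_inv]
    refine Real.sqrt_le_sqrt ?_
    rw [div_le_iff₀ hm0, ← div_eq_inv_mul, le_div_iff₀ hc₁]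
    linarith
  calc _ = |ξ| ^ (α / 2) * (√|3 * ξ|)⁻¹ +
        |ξ| ^ (α / 2) * (√|3 * ξ|)⁻¹ * (√|m / (3 * ξ)|)⁻¹ := by ring
    _ ≤ _ := by linarith

/-- Uniform bound for the kernel on the frequency region. -/
theorem exists_rpow_mul_bilinearKernel_le {ε b c₁ c₂ : ℝ} (hε : 0 < ε) (hb : 1 / 2 < b)
    (hc₁ : 0 < c₁) (hc₂ : 0 < c₂) :
    ∃ C : ℝ≥0∞, C < ∞ ∧ ∀ α : ℝ, 0 ≤ α → α ≤ 1 → ∀ (τ ξ : ℝ) (q : ℤ),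
      (ξ, q) ∈ freqRegion α c₁ c₂ →
        ENNReal.ofReal (|ξ| ^ (α / 2)) * bilinearKernel ε b τ ξ q ≤ C := by
  -- Only a small part of the regularity is used; the sum over `p` was bounded for `δ ≤ 1/2`.
  have hδ : 0 < min ε (1 / 2) := by positivity
  refine ⟨kernelConst (min ε (1 / 2)) b * ENNReal.ofReal (1 + (√c₂)⁻¹ + (√c₁)⁻¹),
    ENNReal.mul_lt_top (kernelConst_lt_top hδ hb) ENNReal.ofReal_lt_top,
    fun α h0 h1 τ ξ q ⟨hm, hξ⟩ => ?_⟩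
  simp only at hm hξ
  have hx : 0 < |ξ| := hc₂.trans_le hξ
  have hm0 : 0 < |3 * ξ ^ 2 - (q : ℝ) ^ 2| := lt_of_lt_of_le (by positivity) hm
  refine (mul_le_mul_right (bilinearKernel_le hδ (min_le_right _ _) (min_le_left _ _)
    (by linarith) τ (abs_pos.1 hx) (abs_pos.1 hm0)) _).trans ?_
  rw [mul_left_comm, ← ENNReal.ofReal_mul (by positivity)]
  gcongr
  exact rpow_mul_inv_sqrt_mul_le h1 hc₁ hc₂ hξ hm h0

/-! ### Weighted Cauchy-Schwarz for convolutions -/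

section Convolution

variable {G : Type*} [MeasurableSpace G] [AddCommGroup G] [MeasurableAdd₂ G] [MeasurableNeg G]
  {μ : Measure G} [SFinite μ] [μ.IsAddRightInvariant]

theorem sq_lintegral_mul_le {α : Type*} [MeasurableSpace α] (ν : Measure α) {f g : α → ℝ≥0∞}
    (hf : AEMeasurable f ν) (hg : AEMeasurable g ν) :
    (∫⁻ x, f x * g x ∂ν) ^ 2 ≤ (∫⁻ x, f x ^ 2 ∂ν) * ∫⁻ x, g x ^ 2 ∂ν := by
  have h := ENNReal.lintegral_mul_le_Lp_mul_Lq ν Real.HolderConjugate.two_two hf hg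
  simp only [Pi.mul_apply, ENNReal.rpow_ofNat] at h
  calc _ ≤ ((∫⁻ x, f x ^ 2 ∂ν) ^ (1 / 2 : ℝ) * (∫⁻ x, g x ^ 2 ∂ν) ^ (1 / 2 : ℝ)) ^ 2 := by gcongr
    _ = _ := by
      rw [mul_pow, ← ENNReal.rpow_ofNat, ← ENNReal.rpow_ofNat, ← ENNReal.rpow_mul,
        ← ENNReal.rpow_mul]
      norm_num

theorem lintegral_lintegral_mul_sub {f g : G → ℝ≥0∞} (hf : Measurable f) (hg : Measurable g) :
    ∫⁻ ζ, ∫⁻ η, f η * g (ζ - η) ∂μ ∂μ = (∫⁻ η, f η ∂μ) * ∫⁻ η, g η ∂μ := by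
  rw [lintegral_lintegral_swap (by fun_prop), ← lintegral_mul_const _ hf]
  refine lintegral_congr fun η => ?_
  rw [lintegral_const_mul _ (by fun_prop), lintegral_sub_right_eq_self g η]

/-- A weighted `L²` bound for the convolution of two functions, with a multiplier `M`, follows
from a pointwise bound for the convolution of the inverse weights. -/
theorem lintegral_mul_sq_convolution_le {f g w : G → ℝ≥0∞} {M : G → ℝ≥0∞} {C : ℝ≥0∞}
    (hf : Measurable f) (hg : Measurable g) (hw : Measurable w)
    (hw0 : ∀ η, w η ≠ 0) (hw1 : ∀ η, w η ≠ ∞)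
    (hM : ∀ ζ, M ζ ^ 2 * ∫⁻ η, (w η)⁻¹ * (w (ζ - η))⁻¹ ∂μ ≤ C) :
    ∫⁻ ζ, M ζ ^ 2 * (∫⁻ η, f η * g (ζ - η) ∂μ) ^ 2 ∂μ ≤
      C * ((∫⁻ η, w η * f η ^ 2 ∂μ) * ∫⁻ η, w η * g η ^ 2 ∂μ) := by
  have hroot : ∀ x : ℝ≥0∞, (x ^ (1 / 2 : ℝ)) ^ 2 = x := fun x => by
    rw [← ENNReal.rpow_ofNat, ← ENNReal.rpow_mul]; norm_num
  set W : G → ℝ≥0∞ := fun η => w η ^ (1 / 2 : ℝ) with hWdef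
  have hW : Measurable W := by fun_prop
  have hW0 : ∀ η, W η ≠ 0 := fun η => by simp [hWdef, hw0, hw1]
  have hW1 : ∀ η, W η ≠ ∞ := fun η => by simp [hWdef, hw0, hw1]
  have hWsq : ∀ η, W η ^ 2 = w η := fun η => hroot _
  have point : ∀ ζ, M ζ ^ 2 * (∫⁻ η, f η * g (ζ - η) ∂μ) ^ 2 ≤
      C * ∫⁻ η, (w η * f η ^ 2) * (w (ζ - η) * g (ζ - η) ^ 2) ∂μ := fun ζ => by
    -- Inserting the square roots `W` of the weights, so that Cauchy-Schwarz puts all inverse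
    -- weights into one factor, the one controlled by `hM`.
    have h1 : ∀ η, f η * g (ζ - η) =
        ((W η)⁻¹ * (W (ζ - η))⁻¹) * ((W η * f η) * (W (ζ - η) * g (ζ - η))) := fun η => by
      have e1 := ENNReal.inv_mul_cancel (hW0 η) (hW1 η)
      have e2 := ENNReal.inv_mul_cancel (hW0 (ζ - η)) (hW1 (ζ - η))
      calc _ = ((W η)⁻¹ * W η * f η) * ((W (ζ - η))⁻¹ * W (ζ - η) * g (ζ - η)) := by
            rw [e1, e2, one_mul, one_mul]
        _ = _ := by ring
    calc _ ≤ M ζ ^ 2 * ((∫⁻ η, ((W η)⁻¹ * (W (ζ - η))⁻¹) ^ 2 ∂μ) *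
          ∫⁻ η, ((W η * f η) * (W (ζ - η) * g (ζ - η))) ^ 2 ∂μ) := by
          rw [lintegral_congr h1]
          gcongr
          exact sq_lintegral_mul_le μ (by fun_prop) (by fun_prop)
      _ = (M ζ ^ 2 * ∫⁻ η, (w η)⁻¹ * (w (ζ - η))⁻¹ ∂μ) *
          ∫⁻ η, (w η * f η ^ 2) * (w (ζ - η) * g (ζ - η) ^ 2) ∂μ := by
          simp only [mul_pow, ← ENNReal.inv_pow, hWsq]
          ring
      _ ≤ _ := by gcongr; exact hM ζ
  calc _ ≤ ∫⁻ ζ, C * ∫⁻ η, (w η * f η ^ 2) * (w (ζ - η) * g (ζ - η) ^ 2) ∂μ ∂μ :=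
        lintegral_mono point
    _ = _ := by
        rw [lintegral_const_mul _ (Measurable.lintegral_prod_right' (f := fun p : G × G =>
            (w p.2 * f p.2 ^ 2) * (w (p.1 - p.2) * g (p.1 - p.2) ^ 2)) (by fun_prop)),
          lintegral_lintegral_mul_sub (f := fun η => w η * f η ^ 2)
            (g := fun η => w η * g η ^ 2) (by fun_prop) (by fun_prop)]

end Convolution

/-! ### Products and convolutions on Euclidean space -/

section Plancherel

variable {E : Type*} [NormedAddCommGroup E] [InnerProductSpace ℝ E] [FiniteDimensional ℝ E]
  [MeasurableSpace E] [BorelSpace E]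

theorem fourier_comp_sub_left (g : SchwartzMap E ℂ) (ζ z : E) :
    𝓕 (fun η => (𝓕 g : SchwartzMap E ℂ) (ζ - η)) z =
      (Real.fourierChar (-inner ℝ z ζ) : ℂ) * g z := by
  have h1 : 𝓕⁻ (⇑(𝓕 g : SchwartzMap E ℂ)) z = g z := by
    rw [← SchwartzMap.fourierInv_coe, FourierTransform.fourierInv_fourier_eq]
  rw [← h1, Real.fourier_eq, Real.fourierInv_eq, ← integral_const_mul,
    ← integral_sub_left_eq_self _ volume ζ]
  refine integral_congr_ae (Filter.Eventually.of_forall fun η => ?_)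
  simp only [sub_sub_cancel, Circle.smul_def, smul_eq_mul]
  rw [← mul_assoc, ← Circle.coe_mul, ← AddChar.map_add_eq_mul, inner_sub_left,
    real_inner_comm z ζ]
  congr 4
  ring

/-- This is the duality `∫ f̂ h = ∫ f ĥ` applied to `h = ĝ(ζ - ·)`, whose transform is `g` times a
character by Fourier inversion. -/
theorem integral_fourierChar_mul_mul_schwartz (f g : SchwartzMap E ℂ) (ζ : E) :
    ∫ z, (Real.fourierChar (-inner ℝ z ζ) : ℂ) * (f z * g z) = 
      ∫ η, (𝓕 f : SchwartzMap E ℂ) η * (𝓕 g : SchwartzMap E ℂ) (ζ - η) := by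
  have h := VectorFourier.integral_fourierIntegral_smul_eq_flip (L := innerₗ E)
    (e := Real.fourierChar) (μ := volume) (ν := volume)
    Real.continuous_fourierChar continuous_inner
    f.integrable ((𝓕 g : SchwartzMap E ℂ).integrable.comp_sub_left ζ)
  have e1 : ∀ η, VectorFourier.fourierIntegral Real.fourierChar volume (innerₗ E) f η =
      (𝓕 f : SchwartzMap E ℂ) η :=
    fun η => by rw [SchwartzMap.fourier_coe]; rfl
  have e2 : ∀ z, VectorFourier.fourierIntegral Real.fourierChar volume (innerₗ E).flip
      (fun η => (𝓕 g : SchwartzMap E ℂ) (ζ - η)) z =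
        (Real.fourierChar (-inner ℝ z ζ) : ℂ) * g z := fun z => by
    rw [← fourier_comp_sub_left, flip_innerₗ]; rfl
  simp only [e1, e2, smul_eq_mul] at h
  rw [h]
  congr 1 with z
  ring

/-- Multiplication by a character, as a function in `L^∞`. -/
def charLpTop (ζ : E) : Lp ℂ ∞ (volume : Measure E) :=
  MemLp.toLp (fun z => (Real.fourierChar (-inner ℝ z ζ) : ℂ))
    (memLp_top_of_bound (by fun_prop) 1
      (Filter.Eventually.of_forall fun z => (Circle.norm_coe _).le))

/-- The product of a square integrable function with a character. -/
def charMul (ζ : E) : Lp ℂ 2 (volume : Measure E) →L[ℂ] Lp ℂ 2 (volume : Measure E) :=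
  (ContinuousLinearMap.mul ℂ ℂ).holderL volume ∞ 2 2 (charLpTop ζ)

theorem coeFn_charMul (ζ : E) (f : Lp ℂ 2 (volume : Measure E)) :
    charMul ζ f =ᵐ[volume] fun z => (Real.fourierChar (-inner ℝ z ζ) : ℂ) * f z := by
  have h1 := (ContinuousLinearMap.mul ℂ ℂ).coeFn_holder (r := 2) (charLpTop ζ) f
  have h2 : charLpTop ζ =ᵐ[volume] _ := MemLp.coeFn_toLp _
  filter_upwards [h1, h2] with z hz1 hz2
  rw [← hz2]
  exact hz1

/-- Composition of a square integrable function with the reflection `η ↦ ζ - η`. -/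
def compSubLeft (ζ : E) : Lp ℂ 2 (volume : Measure E) →L[ℂ] Lp ℂ 2 (volume : Measure E) :=
  (Lp.compMeasurePreservingₗᵢ (E := ℂ) (p := 2) ℂ (fun η : E => ζ - η)
    (Measure.measurePreserving_sub_left volume ζ)).toContinuousLinearMap

theorem coeFn_compSubLeft (ζ : E) (f : Lp ℂ 2 (volume : Measure E)) :
    compSubLeft ζ f =ᵐ[volume] fun η => f (ζ - η) :=
  Lp.coeFn_compMeasurePreserving f (Measure.measurePreserving_sub_left volume ζ)

variable (E) in
/-- The bilinear pairing `∫ f g` of square integrable functions. -/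
def mulPairing : Lp ℂ 2 (volume : Measure E) →L[ℂ] Lp ℂ 2 (volume : Measure E) →L[ℂ] ℂ :=
  (ContinuousLinearMap.mul ℂ ℂ).lpPairing (volume : Measure E) 2 2

theorem mulPairing_apply (f g : Lp ℂ 2 (volume : Measure E)) :
    mulPairing E f g = ∫ z, f z * g z :=
  (ContinuousLinearMap.mul ℂ ℂ).lpPairing_eq_integral f g

theorem mulPairing_charMul (f g : Lp ℂ 2 (volume : Measure E)) (ζ : E) :
    mulPairing E f (charMul ζ g) =
      ∫ z, (Real.fourierChar (-inner ℝ z ζ) : ℂ) * (f z * g z) := by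
  rw [mulPairing_apply]
  refine integral_congr_ae ?_
  filter_upwards [coeFn_charMul ζ g] with z hz
  rw [hz]
  ring

theorem mulPairing_compSubLeft (f g : Lp ℂ 2 (volume : Measure E)) (ζ : E) :
    mulPairing E f (compSubLeft ζ g) = ∫ η, f η * g (ζ - η) := by
  rw [mulPairing_apply]
  refine integral_congr_ae ?_
  filter_upwards [coeFn_compSubLeft ζ g] with z hz
  rw [hz]

theorem mulPairing_charMul_toLp (f g : SchwartzMap E ℂ) (ζ : E) :
    mulPairing E (f.toLp 2) (charMul ζ (g.toLp 2)) =
      mulPairing E (𝓕 (f.toLp 2)) (compSubLeft ζ (𝓕 (g.toLp 2))) := by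
  rw [mulPairing_charMul, mulPairing_compSubLeft, SchwartzMap.toLp_fourier_eq,
    SchwartzMap.toLp_fourier_eq]
  refine Eq.trans (integral_congr_ae ?_)
    ((integral_fourierChar_mul_mul_schwartz f g ζ).trans (integral_congr_ae ?_))
  · filter_upwards [f.coeFn_toLp 2 volume, g.coeFn_toLp 2 volume] with z h1 h2
    rw [h1, h2]
  · filter_upwards [(𝓕 f : SchwartzMap E ℂ).coeFn_toLp 2 volume,
      (Measure.measurePreserving_sub_left volume ζ).quasiMeasurePreserving.ae
        ((𝓕 g : SchwartzMap E ℂ).coeFn_toLp 2 volume)] with z h1 h2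
    rw [h1, h2]

/-- Continuous functions on `L²` that agree on Schwartz functions are equal. -/
theorem eq_of_eq_toLp {F G : Lp ℂ 2 (volume : Measure E) → ℂ} (hF : Continuous F)
    (hG : Continuous G) (h : ∀ f : SchwartzMap E ℂ, F (f.toLp 2) = G (f.toLp 2))
    (f : Lp ℂ 2 (volume : Measure E)) : F f = G f :=
  congrFun ((SchwartzMap.denseRange_toLpCLM (E := E) (F := ℂ) (p := 2) (μ := volume)
    ENNReal.ofNat_ne_top).equalizer hF hG (funext h)) f

theorem continuous_fourier_L2 :
    Continuous fun f : Lp ℂ 2 (volume : Measure E) => (𝓕 f : Lp ℂ 2 (volume : Measure E)) :=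
  (Lp.fourierTransformₗᵢ E ℂ).continuous

theorem continuous_mulPairing_right (f : Lp ℂ 2 (volume : Measure E)) :
    Continuous fun g => mulPairing E f g :=
  (mulPairing E f).continuous

theorem continuous_mulPairing_left (g : Lp ℂ 2 (volume : Measure E)) :
    Continuous fun f => mulPairing E f g :=
  ((mulPairing E).flip g).continuous

/-- Density in the second argument alone; `x` and `y` stand for a fixed function and its transform.
Density in the first argument then finishes `integral_fourierChar_mul_mul`. -/
theorem mulPairing_charMul_eq_of_toLp {x y : Lp ℂ 2 (volume : Measure E)} {ζ : E}
    (h : ∀ g : SchwartzMap E ℂ, mulPairing E x (charMul ζ (g.toLp 2)) =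
      mulPairing E y (compSubLeft ζ (𝓕 (g.toLp 2)))) (g : Lp ℂ 2 (volume : Measure E)) :
    mulPairing E x (charMul ζ g) = mulPairing E y (compSubLeft ζ (𝓕 g)) := by
  have h1 : Continuous fun g => mulPairing E x (charMul ζ g) :=
    (continuous_mulPairing_right x).comp (charMul ζ).continuous
  have h2 : Continuous fun g : Lp ℂ 2 (volume : Measure E) =>
      mulPairing E y (compSubLeft ζ (𝓕 g)) :=
    (continuous_mulPairing_right y).comp ((compSubLeft ζ).continuous.comp continuous_fourier_L2)
  exact eq_of_eq_toLp h1 h2 h g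

/-- The Fourier transform turns the product of two square integrable functions into the convolution
of their Fourier-Plancherel transforms. -/
theorem integral_fourierChar_mul_mul (f g : Lp ℂ 2 (volume : Measure E)) (ζ : E) :
    ∫ z, (Real.fourierChar (-inner ℝ z ζ) : ℂ) * (f z * g z) =
      ∫ η, (𝓕 f : Lp ℂ 2 (volume : Measure E)) η *
        (𝓕 g : Lp ℂ 2 (volume : Measure E)) (ζ - η) := by
  rw [← mulPairing_charMul, ← mulPairing_compSubLeft]
  exact eq_of_eq_toLp (F := fun f => mulPairing E f (charMul ζ g))
    (G := fun f => mulPairing E (𝓕 f) (compSubLeft ζ (𝓕 g)))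
    (continuous_mulPairing_left _) ((continuous_mulPairing_left _).comp continuous_fourier_L2)
    (fun f => mulPairing_charMul_eq_of_toLp (fun g => mulPairing_charMul_toLp f g ζ) g) f

end Plancherel

/-! ### Fourier series in the periodic variable -/

/-- The complex Hilbert space `L²(ℝ × ℝ)`. -/
abbrev L2Plane : Type := Lp ℂ 2 (volume : Measure Plane)

/-- The `q`-th Fourier coefficient of a square integrable function. -/
def coeffLp (f : L2) (q : ℤ) : L2Plane := (memLp_coeffY (Lp.memLp f) q).toLp (coeffY f q)

theorem coeFn_coeffLp (f : L2) (q : ℤ) : coeffLp f q =ᵐ[volume] coeffY f q := MemLp.coeFn_toLp _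

theorem coeffY_congr_ae {f g : SpaceTime → ℂ} (h : f =ᵐ[volume] g) (q : ℤ) :
    coeffY f q =ᵐ[volume] coeffY g q := by
  filter_upwards [Measure.ae_ae_of_ae_prod h] with z hz
  refine integral_congr_ae ?_
  filter_upwards [hz] with y hy
  rw [hy]

theorem integral_fourier_torus (n : ℤ) :
    ∫ y : Torus, fourier n y = if n = 0 then (2 * π : ℂ) else 0 := by
  split_ifs with h
  · subst h
    simp only [fourier_zero, integral_const]
    simp [Measure.real, AddCircle.measure_univ, Real.pi_pos.le]
  · exact integral_eq_zero_of_add_right_eq_neg (fourier_add_half_inv_index h Real.two_pi_pos)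

theorem norm_fourier_apply (n : ℤ) (y : Torus) : ‖fourier n y‖ = 1 := Circle.norm_coe _

/-- The function `(2π)^(-1/2) e^{iqy} g(t, x)`. -/
def tensorFun (q : ℤ) (g : Plane → ℂ) (p : SpaceTime) : ℂ :=
  ((√(2 * π))⁻¹ : ℝ) * (fourier q p.2 * g p.1)

theorem memLp_tensorFun (q : ℤ) {g : Plane → ℂ} (hg : MemLp g 2 volume) :
    MemLp (tensorFun q g) 2 volume := by
  have h1 : MemLp (fun p : SpaceTime => g p.1) 2 volume := hg.comp_fst volume
  refine MemLp.const_mul (h1.of_le ?_ (Filter.Eventually.of_forall fun p => ?_)) _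
  · exact ((fourier q).continuous.comp continuous_snd).aestronglyMeasurable.mul
      h1.aestronglyMeasurable
  · rw [norm_mul, norm_fourier_apply, one_mul]

theorem coeffY_tensorFun (q q' : ℤ) (g : Plane → ℂ) (z : Plane) :
    coeffY (tensorFun q' g) q z = if q' = q then (√(2 * π) : ℝ) * g z else 0 := by
  have h1 : ∀ y : Torus, fourier (-q) y * tensorFun q' g (z, y) =
      (((√(2 * π))⁻¹ : ℝ) * g z) * fourier (q' - q) y := fun y => by
    rw [tensorFun, sub_eq_add_neg, fourier_add]
    ring
  simp only [coeffY, h1]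
  rw [integral_const_mul, integral_fourier_torus]
  simp only [sub_eq_zero]
  split_ifs
  · rw [mul_right_comm]
    congr 1
    have h2 : (√(2 * π))⁻¹ * (2 * π) = √(2 * π) := by
      rw [inv_mul_eq_div, Real.div_sqrt]
    exact_mod_cast h2
  · rw [mul_zero]

theorem integral_conj_tensorFun_mul (q : ℤ) (g : L2Plane) (h : L2) :
    ∫ p, conj (tensorFun q g p) * h p =
      ((√(2 * π))⁻¹ : ℝ) * ∫ z, conj (g z) * coeffLp h q z := by
  have hi : Integrable (fun p : SpaceTime => conj (tensorFun q g p) * h p)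
      ((volume : Measure Plane).prod (volume : Measure Torus)) := by
    have := (memLp_tensorFun q (Lp.memLp g)).star.integrable_mul (Lp.memLp h)
    exact this
  have e1 := integral_prod _ hi
  refine Eq.trans e1 ?_
  rw [← integral_const_mul]
  refine integral_congr_ae ?_
  filter_upwards [coeFn_coeffLp h q] with z hz
  rw [hz, coeffY, ← mul_assoc, ← integral_const_mul]
  refine integral_congr_ae (Filter.Eventually.of_forall fun y => ?_)
  simp only [tensorFun, map_mul, Complex.conj_ofReal, fourier_neg]
  ring

/-- The isometric embedding `g ↦ (2π)^(-1/2) e^{iqy} g` of `L²(ℝ × ℝ)` into `L²(ℝ × ℝ × 𝕋)`. -/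
def tensorLp (q : ℤ) (g : L2Plane) : L2 :=
  (memLp_tensorFun q (Lp.memLp g)).toLp (tensorFun q g)

theorem coeFn_tensorLp (q : ℤ) (g : L2Plane) : tensorLp q g =ᵐ[volume] tensorFun q g :=
  MemLp.coeFn_toLp _

/-- Identifies the adjoint of the embedding `tensorLp q` as the normalized Fourier coefficient;
orthogonality and completeness below both rest on it. -/
theorem inner_tensorLp (q : ℤ) (g : L2Plane) (h : L2) :
    inner ℂ (tensorLp q g) h = ((√(2 * π))⁻¹ : ℝ) * inner ℂ g (coeffLp h q) := by
  rw [L2.inner_def, L2.inner_def]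
  have h1 := integral_conj_tensorFun_mul q g h
  simp only [RCLike.inner_apply']
  refine Eq.trans (integral_congr_ae ?_) h1
  filter_upwards [coeFn_tensorLp q g] with p hp
  rw [hp]

theorem coeffLp_tensorLp (q q' : ℤ) (g : L2Plane) :
    coeffLp (tensorLp q' g) q = if q' = q then ((√(2 * π) : ℝ) : ℂ) • g else 0 := by
  have h1 : coeffLp (tensorLp q' g) q =ᵐ[volume]
      fun z => if q' = q then (√(2 * π) : ℝ) * g z else 0 := by
    filter_upwards [coeFn_coeffLp (tensorLp q' g) q, coeffY_congr_ae (coeFn_tensorLp q' g) q]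
      with z h1 h2
    rw [h1, h2, coeffY_tensorFun]
  refine Lp.ext (h1.trans ?_)
  split_ifs
  · filter_upwards [Lp.coeFn_smul ((√(2 * π) : ℝ) : ℂ) g] with z hz
    rw [hz]
    rfl
  · filter_upwards [Lp.coeFn_zero ℂ 2 (volume : Measure Plane)] with z hz
    rw [hz]
    rfl

theorem inner_tensorLp_tensorLp (q q' : ℤ) (g g' : L2Plane) :
    inner ℂ (tensorLp q g) (tensorLp q' g') = if q' = q then inner ℂ g g' else 0 := by
  rw [inner_tensorLp, coeffLp_tensorLp]
  split_ifs
  · rw [inner_smul_right, ← mul_assoc, ← Complex.ofReal_mul,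
      inv_mul_cancel₀ (by positivity), Complex.ofReal_one, one_mul]
  · rw [inner_zero_right, mul_zero]

/-- `tensorLp` as a linear isometry. -/
def tensorIsometry (q : ℤ) : L2Plane →ₗᵢ[ℂ] L2 where
  toFun := tensorLp q
  map_add' g g' := by
    refine Lp.ext ?_
    have h1 := Measure.quasiMeasurePreserving_fst (μ := (volume : Measure Plane))
      (ν := (volume : Measure Torus)) |>.ae (Lp.coeFn_add g g')
    filter_upwards [coeFn_tensorLp q (g + g'), coeFn_tensorLp q g, coeFn_tensorLp q g',
      Lp.coeFn_add (tensorLp q g) (tensorLp q g'), h1] with p h1 h2 h3 h4 h5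
    rw [h1, h4, Pi.add_apply, h2, h3]
    simp only [tensorFun, h5, Pi.add_apply]
    ring
  map_smul' c g := by
    refine Lp.ext ?_
    have h1 := Measure.quasiMeasurePreserving_fst (μ := (volume : Measure Plane))
      (ν := (volume : Measure Torus)) |>.ae (Lp.coeFn_smul c g)
    filter_upwards [coeFn_tensorLp q (c • g), coeFn_tensorLp q g,
      Lp.coeFn_smul c (tensorLp q g), h1] with p h1 h2 h4 h5
    rw [h1, RingHom.id_apply, h4, Pi.smul_apply, h2]
    simp only [tensorFun, h5, Pi.smul_apply, smul_eq_mul]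
    ring
  norm_map' g := by
    change ‖tensorLp q g‖ = ‖g‖
    rw [@norm_eq_sqrt_re_inner ℂ, @norm_eq_sqrt_re_inner ℂ, inner_tensorLp_tensorLp, if_pos rfl]

theorem tensorIsometry_apply (q : ℤ) (g : L2Plane) : tensorIsometry q g = tensorLp q g := rfl

theorem orthogonalFamily_tensorIsometry :
    OrthogonalFamily ℂ (fun _ : ℤ => L2Plane) tensorIsometry := fun q q' hq g g' => by
  rw [tensorIsometry_apply, tensorIsometry_apply, inner_tensorLp_tensorLp, if_neg hq.symm]

theorem ae_eq_zero_of_fourier_integral_eq_zero {f : Torus → ℂ} (hf : MemLp f 2 volume)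
    (h : ∀ q : ℤ, ∫ y, fourier (-q) y * f y = 0) : f =ᵐ[volume] 0 := by
  have hf' : MemLp f 2 (AddCircle.haarAddCircle (T := 2 * π)) := hf.haarAddCircle
  have h0 : hf'.toLp f = 0 := by
    refine fourierBasis.repr.injective ?_
    rw [map_zero]
    ext q
    rw [fourierBasis_repr, fourierCoeff_congr_ae hf'.coeFn_toLp, fourierCoeff,
      AddCircle.integral_haarAddCircle]
    simp only [smul_eq_mul]
    rw [h q, smul_zero]
    rfl
  have h1 : f =ᵐ[AddCircle.haarAddCircle (T := 2 * π)] 0 := by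
    filter_upwards [hf'.coeFn_toLp, (Lp.eq_zero_iff_ae_eq_zero.1 h0)] with y h2 h3
    rw [← h2, h3]
  rw [AddCircle.volume_eq_smul_haarAddCircle]
  exact Measure.ae_smul_measure h1 _

/-- There are countably many `q`, so for almost every `z` all coefficients of the slice `h (z, ·)`
vanish at once; the slice is square integrable by Tonelli, and completeness of the characters on the
circle applies to it. -/
theorem eq_zero_of_coeffLp_eq_zero {h : L2} (h0 : ∀ q, coeffLp h q = 0) : h = 0 := by
  have hm : AEStronglyMeasurable h ((volume : Measure Plane).prod (volume : Measure Torus)) :=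
    (Lp.memLp h).aestronglyMeasurable
  have hsq : ∫⁻ p, ‖h p‖ₑ ^ 2 ∂((volume : Measure Plane).prod (volume : Measure Torus)) < ∞ := by
    have := (eLpNorm_lt_top_iff_lintegral_rpow_enorm_lt_top (by norm_num) (by norm_num)).1
      (Lp.memLp h).2
    simp only [ENNReal.toReal_ofNat, ENNReal.rpow_ofNat] at this
    exact this
  rw [lintegral_prod _ (hm.enorm.pow_const 2)] at hsq
  have hfin := ae_lt_top' (hm.enorm.pow_const 2).lintegral_prod_right' hsq.ne
  have hcoeff : ∀ᵐ z : Plane, ∀ q : ℤ, coeffY h q z = 0 := by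
    rw [ae_all_iff]
    intro q
    filter_upwards [coeFn_coeffLp h q, Lp.eq_zero_iff_ae_eq_zero.1 (h0 q)] with z h1 h2
    rw [← h1, h2]
    rfl
  have hz : ∀ᵐ z : Plane, ∫⁻ y : Torus, ‖h (z, y)‖ₑ ^ 2 = 0 := by
    filter_upwards [hfin, hcoeff, hm.prodMk_left] with z h1 h2 h3
    have hL : MemLp (fun y : Torus => h (z, y)) 2 volume := by
      refine ⟨h3, ?_⟩
      rw [eLpNorm_lt_top_iff_lintegral_rpow_enorm_lt_top (by norm_num) (by norm_num)]
      simpa using h1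
    have h4 := ae_eq_zero_of_fourier_integral_eq_zero hL h2
    rw [lintegral_eq_zero_iff' (h3.enorm.pow_const 2)]
    filter_upwards [h4] with y hy
    simp [hy]
  have h5 : ∫⁻ p, ‖h p‖ₑ ^ 2 ∂((volume : Measure Plane).prod (volume : Measure Torus)) = 0 := by
    rw [lintegral_prod _ (hm.enorm.pow_const 2), lintegral_congr_ae hz, lintegral_zero]
  rw [lintegral_eq_zero_iff' (hm.enorm.pow_const 2)] at h5
  refine Lp.eq_zero_iff_ae_eq_zero.2 ?_
  filter_upwards [h5] with p hp
  simpa using hp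

theorem isHilbertSum_tensorIsometry :
    IsHilbertSum ℂ (fun _ : ℤ => L2Plane) tensorIsometry := by
  refine IsHilbertSum.mk orthogonalFamily_tensorIsometry (le_of_eq ?_)
  rw [eq_comm, Submodule.topologicalClosure_eq_top_iff, Submodule.eq_bot_iff]
  intro h hh
  refine eq_zero_of_coeffLp_eq_zero fun q => ?_
  -- Testing `h` against its own `q`-th component turns orthogonality into the vanishing of the
  -- squared norm of `coeffLp h q`.
  have h1 : inner ℂ (tensorLp q (coeffLp h q)) h = 0 :=
    (Submodule.mem_orthogonal _ _).1 hh _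
      (Submodule.mem_iSup_of_mem q ⟨coeffLp h q, rfl⟩)
  rw [inner_tensorLp, mul_eq_zero] at h1
  rcases h1 with h1 | h1
  · rw [Complex.ofReal_eq_zero] at h1
    have : (√(2 * π))⁻¹ ≠ 0 := by positivity
    exact absurd h1 this
  · exact inner_self_eq_zero.1 h1

/-- The isometric isomorphism of `L²(ℝ × ℝ × 𝕋)` onto the square summable families of elements of
`L²(ℝ × ℝ)` that is given by the normalized Fourier coefficients in `y`. -/
def coeffIsometryEquiv : L2 ≃ₗᵢ[ℂ] lp (fun _ : ℤ => L2Plane) 2 :=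
  isHilbertSum_tensorIsometry.linearIsometryEquiv

theorem coeffIsometryEquiv_apply (h : L2) (q : ℤ) :
    coeffIsometryEquiv h q = (((√(2 * π))⁻¹ : ℝ) : ℂ) • coeffLp h q := by
  classical
  refine ext_inner_left ℂ fun g => ?_
  rw [inner_smul_right, ← inner_tensorLp, ← tensorIsometry_apply,
    ← isHilbertSum_tensorIsometry.linearIsometryEquiv_symm_apply_single]
  refine (lp.inner_single_left (𝕜 := ℂ) (G := fun _ : ℤ => L2Plane) q g
    (coeffIsometryEquiv h)).symm.trans ?_
  exact (LinearIsometryEquiv.inner_map_eq_flip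
    isHilbertSum_tensorIsometry.linearIsometryEquiv.symm _ _).symm

/-- The complex conjugate of a square integrable function. -/
def conjLp (a : L2) : L2 := (Lp.memLp a).star.toLp (star a)

theorem coeFn_conjLp (a : L2) : conjLp a =ᵐ[volume] fun p => conj (a p) := MemLp.coeFn_toLp _

theorem coeffY_conj (a : SpaceTime → ℂ) (q : ℤ) (z : Plane) :
    coeffY (fun p => conj (a p)) q z = conj (coeffY a (-q) z) := by
  simp only [coeffY]
  rw [← integral_conj]
  refine integral_congr_ae (Filter.Eventually.of_forall fun y => ?_)
  simp only [map_mul, ← fourier_neg, neg_neg]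

theorem coeFn_coeffLp_conjLp (a : L2) (q : ℤ) :
    coeffLp (conjLp a) q =ᵐ[volume] fun z => conj (coeffLp a (-q) z) := by
  filter_upwards [coeFn_coeffLp (conjLp a) q, coeFn_coeffLp a (-q),
    coeffY_congr_ae (coeFn_conjLp a) q] with z h1 h2 h3
  rw [h1, h2, h3, coeffY_conj]

/-- Turns the bilinear integral into an inner product, to which the isometry applies. The price is
the reflection `q ↦ -q` of the coefficients of `a`. -/
theorem inner_conjLp (a b : L2) : inner ℂ (conjLp a) b = ∫ p, a p * b p := by
  rw [L2.inner_def]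
  refine integral_congr_ae ?_
  filter_upwards [coeFn_conjLp a] with p hp
  rw [hp, RCLike.inner_apply', starRingEnd_self_apply]

theorem inner_coeffLp_conjLp (a b : L2) (q : ℤ) :
    inner ℂ (coeffLp (conjLp a) q) (coeffLp b q) = ∫ z, coeffLp a (-q) z * coeffLp b q z := by
  rw [L2.inner_def]
  refine integral_congr_ae ?_
  filter_upwards [coeFn_coeffLp_conjLp a q] with p hp
  rw [hp, RCLike.inner_apply', starRingEnd_self_apply]

/-- Parseval's identity in the periodic variable. -/
theorem integral_mul_eq_tsum (a b : L2) :
    ∫ p, a p * b p =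
      ∑' q : ℤ, (((2 * π)⁻¹ : ℝ) : ℂ) * ∫ z, coeffLp a (-q) z * coeffLp b q z := by
  rw [← inner_conjLp, ← coeffIsometryEquiv.inner_map_map, lp.inner_eq_tsum]
  refine tsum_congr fun q => ?_
  rw [coeffIsometryEquiv_apply, coeffIsometryEquiv_apply, inner_smul_left, inner_smul_right,
    inner_coeffLp_conjLp, Complex.conj_ofReal, ← mul_assoc, ← Complex.ofReal_mul, ← mul_inv,
    Real.mul_self_sqrt Real.two_pi_pos.le]

/-! ### Fourier transform of a product on space-time -/

/-- The product of a function with a character of `ℝ × ℝ × 𝕋`. -/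
def modFun (ζ : Plane) (q : ℤ) (v : SpaceTime → ℂ) (p : SpaceTime) : ℂ :=
  (Real.fourierChar (-inner ℝ p.1 ζ) : ℂ) * (fourier (-q) p.2 * v p)

theorem memLp_modFun (ζ : Plane) (q : ℤ) (v : L2) : MemLp (modFun ζ q v) 2 volume := by
  refine (Lp.memLp v).of_le ?_ (Filter.Eventually.of_forall fun p => ?_)
  · have h1 : Continuous fun p : SpaceTime => (Real.fourierChar (-inner ℝ p.1 ζ) : ℂ) := by
      fun_prop
    exact h1.aestronglyMeasurable.mul
      (((fourier (-q)).continuous.comp continuous_snd).aestronglyMeasurable.mul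
        (Lp.memLp v).aestronglyMeasurable)
  · rw [modFun, norm_mul, norm_mul, norm_fourier_apply, Circle.norm_coe, one_mul, one_mul]

/-- The product of a square integrable function with a character of `ℝ × ℝ × 𝕋`. -/
def modLp (ζ : Plane) (q : ℤ) (v : L2) : L2 := (memLp_modFun ζ q v).toLp (modFun ζ q v)

theorem coeFn_modLp (ζ : Plane) (q : ℤ) (v : L2) : modLp ζ q v =ᵐ[volume] modFun ζ q v :=
  MemLp.coeFn_toLp _

theorem coeFn_coeffLp_modLp (ζ : Plane) (q p : ℤ) (v : L2) :
    coeffLp (modLp ζ q v) p =ᵐ[volume]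
      fun z => (Real.fourierChar (-inner ℝ z ζ) : ℂ) * coeffLp v (p + q) z := by
  filter_upwards [coeFn_coeffLp (modLp ζ q v) p, coeFn_coeffLp v (p + q),
    coeffY_congr_ae (coeFn_modLp ζ q v) p] with z h1 h2 h3
  rw [h1, h2, h3, coeffY, coeffY, ← integral_const_mul]
  refine integral_congr_ae (Filter.Eventually.of_forall fun y => ?_)
  simp only [modFun]
  rw [neg_add, fourier_add]
  ring

theorem integrable_mul_L2 (u v : L2) : Integrable (fun p => u p * v p) volume :=
  (Lp.memLp u).integrable_mul (Lp.memLp v)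

/-- The character is moved onto `v`, which stays in `L²`, so that Parseval applies to a pairing of
two square integrable functions. -/
theorem fourierL1_mul_eq_integral (u v : L2) (ζ : Plane) (q : ℤ) :
    fourierL1 (fun p => u p * v p) ζ q = ∫ p, u p * modLp ((2 * π)⁻¹ • ζ) q v p := by
  have hi : Integrable (fun p => u p * modFun ((2 * π)⁻¹ • ζ) q v p)
      ((volume : Measure Plane).prod (volume : Measure Torus)) :=
    (Lp.memLp u).integrable_mul (memLp_modFun ((2 * π)⁻¹ • ζ) q v)
  have e1 : ∫ p, u p * modLp ((2 * π)⁻¹ • ζ) q v p =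
      ∫ p, u p * modFun ((2 * π)⁻¹ • ζ) q v p := by
    refine integral_congr_ae ?_
    filter_upwards [coeFn_modLp ((2 * π)⁻¹ • ζ) q v] with p hp
    rw [hp]
  rw [e1, fourierL1, Real.fourier_eq]
  refine Eq.trans ?_ (integral_prod _ hi).symm
  refine integral_congr_ae (Filter.Eventually.of_forall fun z => ?_)
  simp only [coeffY, Circle.smul_def, smul_eq_mul]
  rw [← integral_const_mul]
  refine integral_congr_ae (Filter.Eventually.of_forall fun y => ?_)
  simp only [modFun]
  ring

/-- The Fourier transform of a product is the convolution of the Fourier transforms. -/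
theorem fourierL1_mul_eq_tsum (u v : L2) (ζ : Plane) (q : ℤ) :
    fourierL1 (fun p => u p * v p) ζ q = ∑' p : ℤ, (((2 * π)⁻¹ : ℝ) : ℂ) *
      ∫ η, (𝓕 (coeffLp u (-p)) : L2Plane) η *
        (𝓕 (coeffLp v (p + q)) : L2Plane) ((2 * π)⁻¹ • ζ - η) := by
  rw [fourierL1_mul_eq_integral, integral_mul_eq_tsum]
  refine tsum_congr fun p => ?_
  rw [← integral_fourierChar_mul_mul]
  congr 1
  refine integral_congr_ae ?_
  filter_upwards [coeFn_coeffLp_modLp ((2 * π)⁻¹ • ζ) q p v] with z hz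
  rw [hz]
  ring

theorem lintegral_comp_smul {f : Plane → ℝ≥0∞} (hf : Measurable f) {r : ℝ} (hr : r ≠ 0) :
    ∫⁻ η, f (r • η) = ENNReal.ofReal |(r ^ 2)⁻¹| * ∫⁻ η, f η := by
  rw [← lintegral_map hf (measurable_const_smul r), Measure.map_addHaar_smul volume hr,
    lintegral_smul_measure, smul_eq_mul, finrank_euclideanSpace_fin]

theorem fourierL2_eq (u : L2) (ζ : Plane) (q : ℤ) :
    fourierL2 u ζ q = (𝓕 (coeffLp u q) : L2Plane) ((2 * π)⁻¹ • ζ) := rfl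

theorem measurable_fourierL2 (u : L2) (q : ℤ) : Measurable fun ζ => fourierL2 u ζ q :=
  (Lp.stronglyMeasurable _).measurable.comp (measurable_const_smul _)

theorem lintegral_le_lintegral_comp_smul {f : Plane → ℝ≥0∞} (hf : Measurable f) :
    ∫⁻ η, f η ≤ ∫⁻ η, f ((2 * π)⁻¹ • η) := by
  rw [lintegral_comp_smul hf (by positivity)]
  refine le_mul_of_one_le_left zero_le ?_
  rw [ENNReal.one_le_ofReal, inv_pow, inv_inv, abs_of_pos (by positivity)]
  nlinarith [Real.pi_gt_three]

theorem enorm_fourierL1_mul_le (u v : L2) (ζ : Plane) (q : ℤ) :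
    ‖fourierL1 (fun p => u p * v p) ζ q‖ₑ ≤
      ∑' p : ℤ, ∫⁻ η, ‖fourierL2 u η p‖ₑ * ‖fourierL2 v (ζ - η) (q - p)‖ₑ := by
  rw [fourierL1_mul_eq_tsum]
  refine enorm_tsum_le_tsum_enorm.trans ?_
  -- Undoes the reflection of the index caused by conjugation in Parseval's identity. The remaining
  -- constants are harmless: `(2π)⁻¹ ≤ 1`, and the dilation by `(2π)⁻¹` only increases the integral.
  rw [← (Equiv.neg ℤ).tsum_eq]
  refine ENNReal.tsum_le_tsum fun p => ?_
  rw [Equiv.neg_apply, neg_neg, neg_add_eq_sub]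
  have h1 : ‖(((2 * π)⁻¹ : ℝ) : ℂ)‖ₑ ≤ 1 := by
    rw [← ofReal_norm, ENNReal.ofReal_le_one, Complex.norm_real,
      Real.norm_of_nonneg (by positivity)]
    exact inv_le_one_of_one_le₀ (by linarith [Real.pi_gt_three])
  have hm : Measurable fun η => ‖(𝓕 (coeffLp u p) : L2Plane) η‖ₑ *
      ‖(𝓕 (coeffLp v (q - p)) : L2Plane) ((2 * π)⁻¹ • ζ - η)‖ₑ := by
    refine Measurable.mul (Lp.stronglyMeasurable _).measurable.enorm
      (Measurable.enorm ((Lp.stronglyMeasurable _).measurable.comp ?_))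
    fun_prop
  calc _ ≤ 1 * ∫⁻ η, ‖(𝓕 (coeffLp u p) : L2Plane) η‖ₑ *
        ‖(𝓕 (coeffLp v (q - p)) : L2Plane) ((2 * π)⁻¹ • ζ - η)‖ₑ := by
        rw [enorm_mul]
        gcongr
        refine (enorm_integral_le_lintegral_enorm _).trans (le_of_eq ?_)
        simp only [enorm_mul]
    _ ≤ _ := by
        rw [one_mul]
        refine (lintegral_le_lintegral_comp_smul hm).trans (le_of_eq ?_)
        simp only [fourierL2_eq, smul_sub]

/-! ### Inversion of the space-time Fourier transform -/

theorem enorm_sq_eq_lintegral {f : Plane → ℂ} (hf : MemLp f 2 volume) :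
    ‖hf.toLp f‖ₑ ^ 2 = ∫⁻ η, ‖f η‖ₑ ^ 2 := by
  rw [Lp.enorm_toLp, eLpNorm_eq_lintegral_rpow_enorm_toReal (by norm_num) (by norm_num)]
  simp only [ENNReal.toReal_ofNat, ENNReal.rpow_ofNat]
  rw [← ENNReal.rpow_ofNat, ← ENNReal.rpow_mul]
  norm_num

theorem exists_coeffLp_eq (k : ℤ → L2Plane) (hk : ∑' q, ‖k q‖ₑ ^ 2 < ∞) :
    ∃ g : L2, (∀ q, coeffLp g q = k q) ∧ ‖g‖ₑ ^ 2 ≤ ∑' q, ‖k q‖ₑ ^ 2 := by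
  set c : ℝ := (√(2 * π))⁻¹ with hc
  have hc0 : c ≠ 0 := by positivity
  have hc1 : c ≤ 1 := inv_le_one_of_one_le₀ (by
    rw [Real.one_le_sqrt]; linarith [Real.pi_gt_three])
  have hcn : ‖(c : ℂ)‖ₑ ≤ 1 := by
    rw [← ofReal_norm, ENNReal.ofReal_le_one, Complex.norm_real,
      Real.norm_of_nonneg (by positivity)]
    exact hc1
  have hle : ∀ q, ‖(c : ℂ) • k q‖ₑ ^ 2 ≤ ‖k q‖ₑ ^ 2 := fun q => by
    rw [enorm_smul]
    gcongr
    exact mul_le_of_le_one_left zero_le hcn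
  have hfin : ∑' q, ‖(c : ℂ) • k q‖ₑ ^ 2 < ∞ := (ENNReal.tsum_le_tsum hle).trans_lt hk
  have hsum : Summable fun q => ‖(c : ℂ) • k q‖ ^ 2 := by
    have := ENNReal.summable_toReal hfin.ne
    simpa [ENNReal.toReal_pow, toReal_enorm] using this
  have hmem : Memℓp (fun q => (c : ℂ) • k q) 2 :=
    (memℓp_gen_iff (by norm_num)).2 (by simpa using hsum)
  set w : lp (fun _ : ℤ => L2Plane) 2 := ⟨fun q => (c : ℂ) • k q, hmem⟩ with hw
  refine ⟨coeffIsometryEquiv.symm w, fun q => ?_, ?_⟩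
  · have h1 := coeffIsometryEquiv_apply (coeffIsometryEquiv.symm w) q
    rw [LinearIsometryEquiv.apply_symm_apply] at h1
    exact (smul_right_injective _ (Complex.ofReal_ne_zero.2 hc0) h1).symm
  · have h2 : ‖w‖ ^ 2 = ∑' q, ‖(c : ℂ) • k q‖ ^ 2 := by
      have := lp.norm_rpow_eq_tsum (p := 2) (by norm_num) w
      simp only [ENNReal.toReal_ofNat, Real.rpow_ofNat] at this
      exact this
    have h3 : ‖coeffIsometryEquiv.symm w‖ₑ ^ 2 = ∑' q, ‖(c : ℂ) • k q‖ₑ ^ 2 := by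
      rw [← ofReal_norm, LinearIsometryEquiv.norm_map, ← ENNReal.ofReal_pow (norm_nonneg _), h2,
        ENNReal.ofReal_tsum_of_nonneg (fun q => by positivity) hsum]
      refine tsum_congr fun q => ?_
      rw [ENNReal.ofReal_pow (norm_nonneg _), ofReal_norm]
    rw [h3]
    exact ENNReal.tsum_le_tsum hle

/-- Every square integrable function on `ℝ × ℝ × ℤ` is the Fourier transform of a square integrable
function. -/
theorem exists_fourierL2_eq {H : ℤ → Plane → ℂ} (hm : ∀ q, Measurable (H q))
    (hfin : ∑' q, ∫⁻ ζ, ‖H q ζ‖ₑ ^ 2 < ∞) :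
    ∃ g : L2, (∀ᵐ ζ : Plane, ∀ q : ℤ, fourierL2 g ζ q = H q ζ) ∧
      ‖g‖ₑ ^ 2 ≤ ∑' q, ∫⁻ ζ, ‖H q ζ‖ₑ ^ 2 := by
  have hp : (0 : ℝ) < 2 * π := Real.two_pi_pos
  have hscale : ∀ q, ∫⁻ η, ‖H q ((2 * π) • η)‖ₑ ^ 2 ≤ ∫⁻ ζ, ‖H q ζ‖ₑ ^ 2 := fun q => by
    rw [lintegral_comp_smul (f := fun ζ => ‖H q ζ‖ₑ ^ 2) ((hm q).enorm.pow_const 2) hp.ne']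
    refine mul_le_of_le_one_left zero_le ?_
    rw [ENNReal.ofReal_le_one, abs_of_pos (by positivity)]
    refine inv_le_one_of_one_le₀ ?_
    nlinarith [Real.pi_gt_three]
  -- The dilation by `2π` compensates the one by `(2π)⁻¹` in `fourierL2`.
  have hK : ∀ q, MemLp (fun η => H q ((2 * π) • η)) 2 (volume : Measure Plane) := fun q => by
    refine ⟨((hm q).comp (measurable_const_smul _)).aestronglyMeasurable, ?_⟩
    rw [eLpNorm_lt_top_iff_lintegral_rpow_enorm_lt_top (by norm_num) (by norm_num)]
    simp only [ENNReal.toReal_ofNat, ENNReal.rpow_ofNat]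
    exact (hscale q).trans_lt ((ENNReal.le_tsum q).trans_lt hfin)
  have hnorm : ∀ q, ‖(𝓕⁻ ((hK q).toLp _) : L2Plane)‖ₑ ^ 2 ≤ ∫⁻ ζ, ‖H q ζ‖ₑ ^ 2 := fun q => by
    have : ‖(𝓕⁻ ((hK q).toLp _) : L2Plane)‖ₑ = ‖(hK q).toLp _‖ₑ :=
      (Lp.fourierTransformₗᵢ Plane ℂ).symm.enorm_map _
    rw [this, enorm_sq_eq_lintegral]
    exact hscale q
  obtain ⟨g, hg1, hg2⟩ := exists_coeffLp_eq (fun q => (𝓕⁻ ((hK q).toLp _) : L2Plane))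
    ((ENNReal.tsum_le_tsum hnorm).trans_lt hfin)
  refine ⟨g, ?_, hg2.trans (ENNReal.tsum_le_tsum hnorm)⟩
  rw [ae_all_iff]
  intro q
  have hq : Measure.QuasiMeasurePreserving (fun ζ : Plane => (2 * π)⁻¹ • ζ) volume volume := by
    refine ⟨measurable_const_smul _, ?_⟩
    rw [Measure.map_addHaar_smul volume (inv_ne_zero hp.ne')]
    exact Measure.smul_absolutelyContinuous
  filter_upwards [hq.ae (hK q).coeFn_toLp] with ζ hζ
  rw [fourierL2_eq, hg1 q, fourier_fourierInv_eq, hζ, smul_smul, mul_inv_cancel₀ hp.ne', one_smul]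

/-! ### The bilinear estimate on the frequency side -/

/-- The measure on the frequency space `ℝ × ℝ × ℤ`. -/
abbrev freqMeasure : Measure (Plane × ℤ) := (volume : Measure Plane).prod Measure.count

theorem lintegral_freqMeasure {F : Plane × ℤ → ℝ≥0∞} (hF : Measurable F) :
    ∫⁻ p, F p ∂freqMeasure = ∫⁻ ζ, ∑' q : ℤ, F (ζ, q) := by
  rw [lintegral_prod _ hF.aemeasurable]
  simp only [lintegral_count]

theorem lintegral_freqMeasure_symm {F : Plane × ℤ → ℝ≥0∞} (hF : Measurable F) :
    ∫⁻ p, F p ∂freqMeasure = ∑' q : ℤ, ∫⁻ ζ, F (ζ, q) := by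
  rw [lintegral_prod_symm' _ hF, lintegral_count]

theorem lintegral_plane {F : ℝ × ℝ → ℝ≥0∞} (hF : Measurable F) :
    ∫⁻ ζ : Plane, F (ζ 0, ζ 1) = ∫⁻ x, ∫⁻ s, F (s, x) := by
  have h := (volume_preserving_finTwoArrow ℝ).comp
    (EuclideanSpace.volume_preserving_symm_measurableEquiv_toLp (Fin 2))
  have h1 := h.lintegral_comp hF
  refine Eq.trans ?_ (h1.trans ?_)
  · rfl
  · exact lintegral_prod_symm' _ hF

/-- The weight of the Bourgain norm. -/
def bourgainWeight (ε b : ℝ) (p : Plane × ℤ) : ℝ≥0∞ :=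
  ENNReal.ofReal (bracket₂ (p.1 1) p.2 ^ (2 * ε) *
    bracket (p.1 0 - phase (p.1 1) p.2) ^ (2 * b))

theorem measurable_plane_apply (i : Fin 2) : Measurable fun ζ : Plane => ζ i := by fun_prop

theorem measurable_bourgainWeight (ε b : ℝ) : Measurable (bourgainWeight ε b) := by
  refine measurable_from_prod_countable_left fun q => ?_
  have h0 := measurable_plane_apply 0
  have h1 := measurable_plane_apply 1
  simp only [bourgainWeight, bracket₂, bracket, phase]
  fun_prop

theorem bracket_pos (a : ℝ) : 0 < bracket a := Real.sqrt_pos.2 (by positivity)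

theorem bracket₂_pos (ξ : ℝ) (q : ℤ) : 0 < bracket₂ ξ q := Real.sqrt_pos.2 (by positivity)

theorem bourgainWeight_ne_zero (ε b : ℝ) (p : Plane × ℤ) : bourgainWeight ε b p ≠ 0 := by
  have h1 := bracket_pos (p.1 0 - phase (p.1 1) p.2)
  have h2 := bracket₂_pos (p.1 1) p.2
  rw [bourgainWeight, ne_eq, ENNReal.ofReal_eq_zero, not_le]
  positivity

theorem inv_bourgainWeight (ε b : ℝ) (p : Plane × ℤ) : (bourgainWeight ε b p)⁻¹ =
    ENNReal.ofReal (bracket₂ (p.1 1) p.2 ^ (-(2 * ε)) *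
      bracket (p.1 0 - phase (p.1 1) p.2) ^ (-(2 * b))) := by
  have h1 := bracket_pos (p.1 0 - phase (p.1 1) p.2)
  have h2 := bracket₂_pos (p.1 1) p.2
  rw [bourgainWeight, ← ENNReal.ofReal_inv_of_pos (by positivity), mul_inv,
    Real.rpow_neg h1.le, Real.rpow_neg h2.le]

theorem lintegral_inv_bourgainWeight (ε b : ℝ) (ζ : Plane) (q : ℤ) :
    ∫⁻ η, (bourgainWeight ε b η)⁻¹ * (bourgainWeight ε b ((ζ, q) - η))⁻¹ ∂freqMeasure =
      bilinearKernel ε b (ζ 0) (ζ 1) q := by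
  have hw := measurable_bourgainWeight ε b
  rw [lintegral_freqMeasure_symm (by fun_prop), bilinearKernel]
  refine tsum_congr fun p => ?_
  simp only [inv_bourgainWeight]
  refine lintegral_plane (F := fun y : ℝ × ℝ =>
    ENNReal.ofReal (bracket₂ y.2 p ^ (-(2 * ε)) * bracket (y.1 - phase y.2 p) ^ (-(2 * b))) *
    ENNReal.ofReal (bracket₂ (ζ 1 - y.2) (q - p) ^ (-(2 * ε)) *
      bracket (ζ 0 - y.1 - phase (ζ 1 - y.2) (q - p)) ^ (-(2 * b)))) ?_
  simp only [bracket₂, bracket, phase]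
  fun_prop

/-- The modulus of the Fourier transform as a function on `ℝ × ℝ × ℤ`. -/
def fourierAbs (u : L2) (p : Plane × ℤ) : ℝ≥0∞ := ‖fourierL2 u p.1 p.2‖ₑ

theorem measurable_fourierAbs (u : L2) : Measurable (fourierAbs u) :=
  measurable_from_prod_countable_left fun q => (measurable_fourierL2 u q).enorm

theorem lintegral_bourgainWeight_mul (ε b : ℝ) (u : L2) :
    ∫⁻ p, bourgainWeight ε b p * fourierAbs u p ^ 2 ∂freqMeasure = bourgainNorm ε b u ^ 2 := by
  have hw := measurable_bourgainWeight ε b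
  have hu := measurable_fourierAbs u
  rw [lintegral_freqMeasure (by fun_prop), bourgainNorm, ← ENNReal.rpow_ofNat, ← ENNReal.rpow_mul]
  norm_num
  refine lintegral_congr fun ζ => tsum_congr fun q => ?_
  have h1 := bracket_pos (ζ 0 - phase (ζ 1) q)
  have h2 := bracket₂_pos (ζ 1) q
  rw [ENNReal.ofReal_mul (by positivity), bourgainWeight, fourierAbs,
    ENNReal.ofReal_pow (norm_nonneg _), ofReal_norm]

theorem measurable_fourierL1 {w : SpaceTime → ℂ} (hw : Integrable w volume) (q : ℤ) :
    Measurable fun ζ => fourierL1 w ζ q := by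
  have hi : Integrable (fun p : SpaceTime => fourier (-q) p.2 * w p)
      ((volume : Measure Plane).prod (volume : Measure Torus)) := by
    have hw' : Integrable w ((volume : Measure Plane).prod (volume : Measure Torus)) := hw
    refine hw'.mono (((fourier (-q)).continuous.comp continuous_snd).aestronglyMeasurable.mul
      hw'.aestronglyMeasurable) (Filter.Eventually.of_forall fun p => ?_)
    rw [norm_mul, norm_fourier_apply, one_mul]
  have hc : Continuous (𝓕 (coeffY w q)) :=
    VectorFourier.fourierIntegral_continuous Real.continuous_fourierChar continuous_inner
      hi.integral_prod_left
  exact (hc.comp (continuous_const_smul _)).measurable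

theorem measurable_rieszSymbol_mul_projSymbol (α c₁ c₂ s : ℝ) (q : ℤ) :
    Measurable fun ξ : ℝ => rieszSymbol s ξ q * projSymbol α c₁ c₂ ξ q := by
  have hs : MeasurableSet {ξ : ℝ | (ξ, q) ∈ freqRegion α c₁ c₂} := by
    have h1 : MeasurableSet {ξ : ℝ | c₁ * |ξ| ^ α ≤ |3 * ξ ^ 2 - (q : ℝ) ^ 2|} :=
      measurableSet_le (by fun_prop) (by fun_prop)
    have h2 : MeasurableSet {ξ : ℝ | c₂ ≤ |ξ|} := measurableSet_le (by fun_prop) (by fun_prop)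
    exact h1.inter h2
  have h1 : (fun ξ : ℝ => projSymbol α c₁ c₂ ξ q) =
      {ξ : ℝ | (ξ, q) ∈ freqRegion α c₁ c₂}.indicator 1 := rfl
  refine Measurable.mul ?_ (h1 ▸ measurable_one.indicator hs)
  simp only [rieszSymbol]
  fun_prop

theorem enorm_symbol_sq (α c₁ c₂ ξ : ℝ) (q : ℤ) :
    ‖((rieszSymbol (α / 4) ξ q * projSymbol α c₁ c₂ ξ q : ℝ) : ℂ)‖ₑ ^ 2 =
      (freqRegion α c₁ c₂).indicator (fun _ => ENNReal.ofReal (|ξ| ^ (α / 2))) (ξ, q) := by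
  by_cases h : (ξ, q) ∈ freqRegion α c₁ c₂
  · rw [projSymbol, Set.indicator_of_mem h, Set.indicator_of_mem h, Pi.one_apply, mul_one,
      rieszSymbol, ← ofReal_norm, ← ENNReal.ofReal_pow (norm_nonneg _), Complex.norm_real,
      Real.norm_of_nonneg (by positivity), ← Real.rpow_mul_natCast (abs_nonneg _)]
    congr 2
    push_cast
    ring
  · rw [projSymbol, Set.indicator_of_notMem h, Set.indicator_of_notMem h, mul_zero]
    simp

/-- The bilinear estimate on the Fourier side. -/
theorem tsum_lintegral_symbol_mul_fourierL1_le {ε b c₁ c₂ α : ℝ} {C : ℝ≥0∞}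
    (hC : ∀ (τ ξ : ℝ) (q : ℤ), (ξ, q) ∈ freqRegion α c₁ c₂ →
      ENNReal.ofReal (|ξ| ^ (α / 2)) * bilinearKernel ε b τ ξ q ≤ C) (u v : L2) :
    ∑' q : ℤ, ∫⁻ ζ : Plane,
      ‖((rieszSymbol (α / 4) (ζ 1) q * projSymbol α c₁ c₂ (ζ 1) q : ℝ) : ℂ) *
        fourierL1 (fun p => u p * v p) ζ q‖ₑ ^ 2 ≤
      C * (bourgainNorm ε b u ^ 2 * bourgainNorm ε b v ^ 2) := by
  set M : Plane × ℤ → ℝ≥0∞ := fun p =>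
    ‖((rieszSymbol (α / 4) (p.1 1) p.2 * projSymbol α c₁ c₂ (p.1 1) p.2 : ℝ) : ℂ)‖ₑ with hM
  have hMm : Measurable M := measurable_from_prod_countable_left fun q =>
    (Complex.measurable_ofReal.comp ((measurable_rieszSymbol_mul_projSymbol α c₁ c₂ (α / 4) q).comp
      (measurable_plane_apply 1))).enorm
  have hw := measurable_bourgainWeight ε b
  have hu := measurable_fourierAbs u
  have hv := measurable_fourierAbs v
  have h1 := lintegral_mul_sq_convolution_le (μ := freqMeasure) (C := C) (M := M) hu hv hw
    (bourgainWeight_ne_zero ε b) (fun _ => ENNReal.ofReal_ne_top) (fun ⟨ζ, q⟩ => by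
      rw [lintegral_inv_bourgainWeight, hM, enorm_symbol_sq]
      -- The kernel bound is available only on the frequency region; elsewhere the symbol vanishes.
      by_cases h : (ζ 1, q) ∈ freqRegion α c₁ c₂
      · rw [Set.indicator_of_mem h]
        exact hC _ _ _ h
      · rw [Set.indicator_of_notMem h, zero_mul]
        exact zero_le)
  rw [lintegral_bourgainWeight_mul, lintegral_bourgainWeight_mul] at h1
  refine le_trans ?_ h1
  have hconv : Measurable fun ζ : Plane × ℤ =>
      ∫⁻ η, fourierAbs u η * fourierAbs v (ζ - η) ∂freqMeasure :=
    Measurable.lintegral_prod_right' (f := fun p : (Plane × ℤ) × (Plane × ℤ) =>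
      fourierAbs u p.2 * fourierAbs v (p.1 - p.2)) (by fun_prop)
  rw [lintegral_freqMeasure_symm (by fun_prop)]
  refine ENNReal.tsum_le_tsum fun q => lintegral_mono fun ζ => ?_
  rw [enorm_mul, mul_pow]
  gcongr
  refine (enorm_fourierL1_mul_le u v ζ q).trans (le_of_eq ?_)
  rw [lintegral_freqMeasure_symm (by fun_prop)]
  rfl

end ZK

theorem mainTheorem5 (ε b c₁ c₂ : ℝ) (hε : 0 < ε) (hb : 1 / 2 < b) (hc₁ : 0 < c₁) (hc₂ : 0 < c₂) :
    ∃ C : ℝ, 0 < C ∧ ∀ α : ℝ, 0 ≤ α → α ≤ 1 →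
      ∀ u ∈ ZK.bourgainSpace ε b, ∀ v ∈ ZK.bourgainSpace ε b,
        ∃ g : ZK.L2,
          ZK.IsMultiplierImage
            (fun ξ q => ZK.rieszSymbol (α / 4) ξ q * ZK.projSymbol α c₁ c₂ ξ q)
            (fun p => u p * v p) g ∧
          ENNReal.ofReal ‖g‖ ≤
            ENNReal.ofReal C * ZK.bourgainNorm ε b u * ZK.bourgainNorm ε b v := by
  obtain ⟨C, hC, hker⟩ := ZK.exists_rpow_mul_bilinearKernel_le hε hb hc₁ hc₂
  -- `C` bounds the square of the norm; `C ≤ (C + 1)²` avoids a square root, and adding `1` makes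
  -- the constant positive.
  refine ⟨C.toReal + 1, by positivity, fun α h0 h1 u hu v hv => ?_⟩
  have hest := ZK.tsum_lintegral_symbol_mul_fourierL1_le (hker α h0 h1) u v
  have hfin : C * (ZK.bourgainNorm ε b u ^ 2 * ZK.bourgainNorm ε b v ^ 2) < ∞ :=
    ENNReal.mul_lt_top hC (ENNReal.mul_lt_top (ENNReal.pow_lt_top hu) (ENNReal.pow_lt_top hv))
  obtain ⟨g, hg1, hg2⟩ := ZK.exists_fourierL2_eq (H := fun q ζ =>
    ((ZK.rieszSymbol (α / 4) (ζ 1) q * ZK.projSymbol α c₁ c₂ (ζ 1) q : ℝ) : ℂ) *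
      ZK.fourierL1 (fun p => u p * v p) ζ q) (fun q =>
    (Complex.measurable_ofReal.comp
      ((ZK.measurable_rieszSymbol_mul_projSymbol α c₁ c₂ (α / 4) q).comp
        (ZK.measurable_plane_apply 1))).mul
      (ZK.measurable_fourierL1 (ZK.integrable_mul_L2 u v) q)) (hest.trans_lt hfin)
  refine ⟨g, ⟨ZK.integrable_mul_L2 u v, hg1⟩, ?_⟩
  have hC1 : C ≤ ENNReal.ofReal (C.toReal + 1) ^ 2 := by
    have h2 : C.toReal ≤ (C.toReal + 1) ^ 2 := by nlinarith [ENNReal.toReal_nonneg (a := C)]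
    rw [← ENNReal.ofReal_pow (by positivity), ← ENNReal.ofReal_toReal hC.ne]
    refine (ENNReal.ofReal_le_ofReal h2).trans (le_of_eq ?_)
    rw [ENNReal.ofReal_toReal hC.ne]
  rw [ofReal_norm, ← ENNReal.pow_le_pow_left_iff two_ne_zero, mul_pow, mul_pow, mul_assoc]
  exact (hg2.trans hest).trans (by gcongr)

end
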